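/- Let $k$ be a field of characteristic different from $2$, and let $R=\bigoplus_{i\ge 0}R_i$ be an Artinian standard graded $k$-algebra, i.e. $R$ is a commutative graded Artinian ring with $R_0=k$ and $R=k[R_1]$. Let $\mathfrak m$ be the ideal generated by all elements of positive degree, let $\operatorname{Soc}$ denote the socle (the sum of all minimal nonzero ideals), and let $\omega=\operatorname{Hom}_k(R,k)$ be the graded canonical module of $R$, with $\omega_i=\operatorname{Hom}_k(R_{-i},k)$ and $\omega(t)_i=\omega_{t+i}$. The following are equivalent: (1) Either $R\cong k[X_1,\dots,X_n]/(X_1,\dots,X_n)^2$ as graded $k$-algebras for some $n\ge 0$, or $\operatorname{Soc}(R)\subseteq\mathfrak m^2$ and there is a surjective $R$-linear homomorphism $f:\omega(t)\to\mathfrak m$, graded of degree $0$, for some $t\in\mathbb Z$. (2) $R$ is, as a graded $k$-algebra, the quotient $S/\operatorname{Soc}(S)$ of an Artinian standard graded Gorenstein (i.e. self-injective) $k$-algebra $S$ by its socle. Moreover, if $\operatorname{Soc}(R)\subseteq\mathfrak m^2$ and $f:\omega(t)\to\mathfrak m$ is any surjective $R$-linear homomorphism, graded of degree $0$, then the graded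 $k$-vector space $S=k\oplus\omega(t)$ ($k$ in degree $0$) with unit $(1,0)$ and multiplication $$(\alpha_1,x_1)(\alpha_2,x_2)=\Bigl(\alpha_1\alpha_2,\ \alpha_1x_2+\alpha_2x_1+\tfrac{1}{2}\bigl(f(x_2)x_1+f(x_1)x_2\bigr)\Bigr)$$ is an Artinian standard graded Gorenstein $k$-algebra, and $(\alpha,x)\mapsto\alpha+f(x)$ is a surjective graded $k$-algebra homomorphism $S\to R$ whose kernel is $\operatorname{Soc}(S)$. -/

import Mathlib

universe u v

/-- The socle of a commutative ring: the sum of its minimal nonzero ideals (simple submodules). -/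
def socle (A : Type v) [CommRing A] : Ideal A :=
  sSup {I : Ideal A | IsSimpleModule A I}

/-- An Artinian Gorenstein ring: an Artinian ring that is injective as a module over itself
(injective dimension zero, which is what finite injective dimension means for Artinian rings). -/
structure IsArtinianGorenstein (A : Type v) [CommRing A] : Prop where
  artinian : IsArtinianRing A
  injective : Module.Injective A A

/-- A graded `k`-algebra `A` is standard graded over the field `k` if `A₀ = k` and `A = k[A₁]`.
(Noetherianity is a consequence of Artinianity wherever this is used.) -/
structure IsStandardGraded {k : Type u} {A : Type v} [Field k] [CommRing A] [Algebra k A]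
    (𝒜 : ℕ → Submodule k A) : Prop where
  algebraMap_injective : Function.Injective (algebraMap k A)
  mem_zero_iff : ∀ a : A, a ∈ 𝒜 0 ↔ ∃ c : k, algebraMap k A c = a
  adjoin_one : Algebra.adjoin k (𝒜 1 : Set A) = ⊤

/-- The canonical module of an Artinian standard graded `k`-algebra `R`: the `k`-dual
`Hom_k(R, k)`, with `R` acting by `(r • φ)(x) = φ (r x)`. Its grading is `canonicalGrading`. -/
def CanonicalModule (k : Type u) (R : Type v) [Field k] [CommRing R] [Algebra k R] :
    Type (max u v) :=
  R →ₗ[k] k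

namespace CanonicalModule

variable {k : Type u} {R : Type v} [Field k] [CommRing R] [Algebra k R]

noncomputable instance : AddCommGroup (CanonicalModule k R) :=
  inferInstanceAs (AddCommGroup (R →ₗ[k] k))

noncomputable instance : Module k (CanonicalModule k R) :=
  inferInstanceAs (Module k (R →ₗ[k] k))

instance : FunLike (CanonicalModule k R) R k :=
  inferInstanceAs (FunLike (R →ₗ[k] k) R k)

theorem ext {φ ψ : CanonicalModule k R} (h : ∀ x, φ x = ψ x) : φ = ψ :=
  DFunLike.ext _ _ h

theorem add_apply (φ ψ : CanonicalModule k R) (x : R) : (φ + ψ) x = φ x + ψ x := rfl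

theorem zero_apply (x : R) : (0 : CanonicalModule k R) x = 0 := rfl

theorem coe_smul_apply (c : k) (φ : CanonicalModule k R) (x : R) : (c • φ) x = c * φ x := rfl

theorem map_add' (φ : CanonicalModule k R) (x y : R) : φ (x + y) = φ x + φ y :=
  LinearMap.map_add (show R →ₗ[k] k from φ) x y

theorem map_zero' (φ : CanonicalModule k R) : φ 0 = 0 :=
  LinearMap.map_zero (show R →ₗ[k] k from φ)

noncomputable instance : SMul R (CanonicalModule k R) where
  smul r φ := LinearMap.comp (show R →ₗ[k] k from φ) (LinearMap.mulLeft k r)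

theorem smul_apply (r : R) (φ : CanonicalModule k R) (x : R) : (r • φ) x = φ (r * x) := rfl

noncomputable instance : Module R (CanonicalModule k R) where
  one_smul φ := ext fun x => by rw [smul_apply, one_mul]
  mul_smul r s φ := ext fun x => by
    rw [smul_apply, smul_apply, smul_apply, ← mul_assoc, mul_comm s r]
  smul_zero r := ext fun x => by rw [smul_apply, zero_apply, zero_apply]
  smul_add r φ ψ := ext fun x => by simp only [smul_apply, add_apply]
  add_smul r s φ := ext fun x => by simp only [smul_apply, add_apply, add_mul, map_add']
  zero_smul φ := ext fun x => by rw [smul_apply, zero_mul, map_zero', zero_apply]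

end CanonicalModule

section Graded

variable {k : Type u} {R : Type v} [Field k] [CommRing R] [Algebra k R]

/-- The grading of the canonical module: `ω_i = Hom_k(R_{-i}, k)`, i.e. the functionals that
vanish on all `R_j` with `j ≠ -i`. -/
def canonicalGrading (𝒜 : ℕ → Submodule k R) (i : ℤ) : Submodule k (CanonicalModule k R) where
  carrier := {φ | ∀ j : ℕ, (j : ℤ) ≠ -i → ∀ a ∈ 𝒜 j, φ a = 0}
  zero_mem' := fun _ _ _ _ => rfl
  add_mem' := fun hφ hψ j hj a ha => by
    rw [CanonicalModule.add_apply, hφ j hj a ha, hψ j hj a ha, add_zero]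
  smul_mem' := fun c φ hφ j hj a ha => by
    rw [CanonicalModule.coe_smul_apply, hφ j hj a ha, mul_zero]

/-- The grading of `R` seen as a `ℤ`-grading, with `R_i = 0` for `i < 0`. -/
def intGrading (𝒜 : ℕ → Submodule k R) : ℤ → Submodule k R
  | Int.ofNat n => 𝒜 n
  | Int.negSucc _ => ⊥

/-- The homogeneous maximal ideal `𝔪`, generated by all elements of positive degree. -/
def gradedMaximalIdeal (𝒜 : ℕ → Submodule k R) : Ideal R :=
  Ideal.span {a | ∃ i : ℕ, 0 < i ∧ a ∈ 𝒜 i}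

/-- The `R`-linear map `f : ω → 𝔪` is a degree `0` graded surjection `ω(t) → 𝔪`,
where `ω(t)_i = ω_{t+i}`. -/
structure IsGradedSurjection (𝒜 : ℕ → Submodule k R) (t : ℤ)
    (f : CanonicalModule k R →ₗ[R] gradedMaximalIdeal 𝒜) : Prop where
  surjective : Function.Surjective f
  degree_zero : ∀ i : ℤ, ∀ x ∈ canonicalGrading 𝒜 (t + i), (f x : R) ∈ intGrading 𝒜 i

/-- `R ≅ k[X₁,…,Xₙ]/(X₁,…,Xₙ)²` as graded `k`-algebras, for some `n ≥ 0`. -/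
def IsPolynomialModSquare (𝒜 : ℕ → Submodule k R) : Prop :=
  ∃ (n : ℕ) (e : R ≃ₐ[k] (MvPolynomial (Fin n) k ⧸
      (Ideal.span (Set.range (MvPolynomial.X : Fin n → MvPolynomial (Fin n) k))) ^ 2)),
    ∀ (i : ℕ) (a : R), a ∈ 𝒜 i ↔
      ∃ p : MvPolynomial (Fin n) k, p.IsHomogeneous i ∧ Ideal.Quotient.mk _ p = e a

/-- The graded `k`-algebra `S` is Artinian, standard graded and Gorenstein, and `π` is a graded
surjection onto `R` whose kernel is the socle of `S`; that is, `π` exhibits `R` as `S / Soc(S)`. -/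
structure IsGorensteinModSocle {S : Type (max u v)} [CommRing S] [Algebra k S]
    (𝒮 : ℕ → Submodule k S) (𝒜 : ℕ → Submodule k R) (π : S →ₐ[k] R) : Prop where
  standard : IsStandardGraded 𝒮
  gorenstein : IsArtinianGorenstein S
  surjective : Function.Surjective π
  graded : ∀ i : ℕ, ∀ s ∈ 𝒮 i, π s ∈ 𝒜 i
  ker_eq : RingHom.ker π = socle S

end Graded

/-! Write 𝔪 for the maximal ideal of `R` and ω for its canonical module.

Suppose R = S/Soc(S) with S Gorenstein of top degree d. Then S carries a functional l concentrated
in degree d whose pairing l(ab) is nondegenerate. The pullback to S of a functional on R is l(g·)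
for a unique g; since it vanishes on Soc(S), g lies in 𝔪_S, and sending the functional to π(g) is
the required surjection ω(-d) → 𝔪 (`exists_isGradedSurjection`). The socle of R sits in degree d - 1
(`mem_of_mem_socle_quotient`), hence in 𝔪² if d ≥ 3. If d ≤ 2, then R vanishes in degrees ≥ 2 and is
a polynomial ring modulo the square of the variables.

Conversely, let f : ω → 𝔪 be a surjection. As dim ω = dim 𝔪 + 1, its kernel is a line; nilpotency
makes 𝔪 kill it, so it is spanned by the augmentation ε : R → k. Now f(x)z - f(z)x lies in ker f, so
f(y)f(x)z = f(y)f(z)x, which is what associativity of the product on k ⊕ ω needs. The rest hinges on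
one condition: the form f(y)x + f(x)y has its radical inside ker f. It makes (α, x) ↦ x(1) a
nondegenerate functional, so that S is self-injective; it identifies Soc(S) with kε; and, if 𝔪 ≠ 0,
it exhibits ε up to a scalar as a product of two elements of the maximal ideal, so that S is
generated in degree one (`exists_gorenstein_cover`).

If Soc(R) ⊆ 𝔪², the condition holds (`toRing_eq_zero_of_socle_le`): for x in the radical, 2f(y)f(x)
= 0 puts f(x) in Soc(R), hence in 𝔪²; there the commutation rule gives f(y)x = f(x)y, so 2f(x)ω = 0,
and ω is faithful. If 𝔪² = 0 ≠ 𝔪, the map f is chosen by hand, identifying R₁ with its dual through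
a basis; 𝔪 = 0 is covered by f = 0. -/

/-! ### Socle and finiteness for algebras of the form k + (nilpotent ideal). -/

section Nilpotent

variable {k : Type u} {A : Type v} [Field k] [CommRing A] [Algebra k A]

/-- A nonzero ideal contains a nonzero element annihilated by a given nilpotent ideal. -/
theorem exists_mem_ne_zero_of_isNilpotent {n I : Ideal A} (hn : IsNilpotent n) (hI : I ≠ ⊥) :
    ∃ z ∈ I, z ≠ 0 ∧ ∀ a ∈ n, a * z = 0 := by
  classical
  -- Take the least power of `n` that kills `I`: the product one step earlier is nonzero and is
  -- annihilated by `n`.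
  have hex : ∃ j, n ^ j * I = ⊥ := by
    obtain ⟨N, hN⟩ := hn
    exact ⟨N, by rw [hN]; exact zero_mul I⟩
  have hspec := Nat.find_spec hex
  have hpos : Nat.find hex ≠ 0 := fun h => by
    rw [h, pow_zero, one_mul] at hspec
    exact hI hspec
  obtain ⟨j, hj⟩ := Nat.exists_eq_succ_of_ne_zero hpos
  have hmin : n ^ j * I ≠ ⊥ := Nat.find_min hex (by omega)
  obtain ⟨z, hz, hz0⟩ := Submodule.exists_mem_ne_zero_of_ne_bot hmin
  refine ⟨z, (Ideal.mul_le_right : n ^ j * I ≤ I) hz, hz0, fun a ha => ?_⟩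
  have : a * z ∈ n ^ (j + 1) * I := by
    rw [pow_succ', mul_assoc]
    exact Ideal.mul_mem_mul ha hz
  rw [hj] at hspec
  rw [hspec] at this
  exact this

/-- If `A = k + 𝔫` with `𝔫` nilpotent, the socle of `A` is the annihilator of `𝔫`. -/
theorem mem_socle_iff {n : Ideal A} (hn : IsNilpotent n)
    (hk : ∀ a : A, ∃ c : k, a - algebraMap k A c ∈ n) {z : A} :
    z ∈ socle A ↔ ∀ a ∈ n, a * z = 0 := by
  constructor
  · intro hz a ha
    have hle : socle A ≤ LinearMap.ker (LinearMap.mulLeft A a) := by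
      refine sSup_le fun I hI => ?_
      have hI : IsSimpleModule A I := hI
      have hI' : IsAtom I := isSimpleModule_iff_isAtom.mp hI
      obtain ⟨w, hw, hw0, hwn⟩ := exists_mem_ne_zero_of_isNilpotent hn hI'.1
      have hspan : Ideal.span {w} = I := by
        refine (hI'.le_iff.mp ((Ideal.span_singleton_le_iff_mem I).mpr hw)).resolve_left ?_
        rwa [Ideal.span_singleton_eq_bot]
      intro x hx
      rw [← hspan] at hx
      obtain ⟨b, rfl⟩ := Ideal.mem_span_singleton'.mp hx
      rw [LinearMap.mem_ker, LinearMap.mulLeft_apply, mul_left_comm, hwn a ha, mul_zero]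
    exact hle hz
  · intro hz
    by_cases hz0 : z = 0
    · rw [hz0]; exact zero_mem _
    have hsimple : IsSimpleModule A (Ideal.span {z}) := by
      rw [isSimpleModule_iff_isAtom]
      refine ⟨by rwa [Ne, Ideal.span_singleton_eq_bot], fun J hJ => ?_⟩
      by_contra hJ0
      obtain ⟨w, hw, hw0⟩ := Submodule.exists_mem_ne_zero_of_ne_bot hJ0
      obtain ⟨b, rfl⟩ := Ideal.mem_span_singleton'.mp (hJ.le hw)
      obtain ⟨c, hc⟩ := hk b
      have hbz : b * z = algebraMap k A c * z := by
        have := hz _ hc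
        rwa [sub_mul, sub_eq_zero] at this
      have hc0 : c ≠ 0 := fun h => hw0 (by rw [hbz, h, map_zero, zero_mul])
      refine hJ.not_ge ((Ideal.span_singleton_le_iff_mem J).mpr ?_)
      have : z = algebraMap k A c⁻¹ * (b * z) := by
        rw [hbz, ← mul_assoc, ← map_mul, inv_mul_cancel₀ hc0, map_one, one_mul]
      rw [this]
      exact Ideal.mul_mem_left J _ hw
    exact (le_sSup (show Ideal.span {z} ∈ {I : Ideal A | IsSimpleModule A I} from hsimple))
      (Ideal.mem_span_singleton_self z)

/-- An ideal annihilated by a power of a nilpotent ideal `𝔫` with `A = k + 𝔫` is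
finite-dimensional if `A` is Noetherian. -/
theorem fg_restrictScalars_of_pow_mul_eq_bot [IsNoetherianRing A] {n : Ideal A}
    (hk : ∀ a : A, ∃ c : k, a - algebraMap k A c ∈ n) (j : ℕ) :
    ∀ I : Ideal A, n ^ j * I = ⊥ → (I.restrictScalars k).FG := by
  induction j with
  | zero =>
    intro I hI
    rw [pow_zero, one_mul] at hI
    rw [hI, Submodule.restrictScalars_bot]
    exact Submodule.fg_bot
  | succ j ih =>
    intro I hI
    obtain ⟨G, hG⟩ : I.FG := (isNoetherianRing_iff_ideal_fg A).mp ‹_› I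
    have hGI : ∀ x, x ∈ I ↔ x ∈ Submodule.span A (G : Set A) := fun x => by
      rw [show Submodule.span A (G : Set A) = I from hG]
    have hfin := ih (n * I) (by rw [← mul_assoc, ← pow_succ, hI])
    -- Splitting each coefficient as a scalar plus an element of `n` leaves a remainder in `n * I`,
    -- which the induction hypothesis controls.
    have heq : I.restrictScalars k =
        Submodule.span k (G : Set A) ⊔ (n * I).restrictScalars k := by
      apply le_antisymm
      · intro x hx
        replace hx := (hGI x).mp hx
        induction hx using Submodule.span_induction with
        | mem x hx => exact Submodule.mem_sup_left (Submodule.subset_span hx)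
        | zero => exact zero_mem _
        | add x y _ _ hx hy => exact add_mem hx hy
        | smul a x hx ihx =>
          obtain ⟨c, hc⟩ := hk a
          have : a • x = c • x + (a - algebraMap k A c) * x := by
            rw [smul_eq_mul, Algebra.smul_def c]; ring
          rw [this]
          exact add_mem (Submodule.smul_mem _ _ ihx)
            (Submodule.mem_sup_right (Ideal.mul_mem_mul hc ((hGI x).mpr hx)))
      · refine sup_le ?_ (fun x hx => (Ideal.mul_le_right : n * I ≤ I) hx)
        rw [Submodule.span_le]
        intro x hx
        exact (hGI x).mpr (Submodule.subset_span hx)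
    rw [heq]
    exact Submodule.FG.sup ⟨G, rfl⟩ hfin

end Nilpotent

/-! ### Graded algebras: projections, truncation ideals, standard generation. -/

section Graded

variable {k : Type u} {A : Type v} [Field k] [CommRing A] [Algebra k A]
  (𝒜 : ℕ → Submodule k A) [GradedAlgebra 𝒜]

open GradedAlgebra

theorem proj_mem (i : ℕ) (a : A) : proj 𝒜 i a ∈ 𝒜 i := by
  rw [proj_apply]; exact SetLike.coe_mem _

variable {𝒜}

theorem proj_eq_self {i : ℕ} {a : A} (ha : a ∈ 𝒜 i) : proj 𝒜 i a = a := by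
  rw [proj_apply, DirectSum.decompose_of_mem_same 𝒜 ha]

theorem proj_eq_zero {i j : ℕ} {a : A} (ha : a ∈ 𝒜 i) (hij : i ≠ j) : proj 𝒜 j a = 0 := by
  rw [proj_apply, DirectSum.decompose_of_mem_ne 𝒜 ha hij]

theorem proj_mul_of_le {i n : ℕ} {a : A} (ha : a ∈ 𝒜 i) (h : i ≤ n) (b : A) :
    proj 𝒜 n (a * b) = a * proj 𝒜 (n - i) b := by
  rw [proj_apply, proj_apply, DirectSum.coe_decompose_mul_of_left_mem_of_le 𝒜 ha h]

theorem proj_mul_of_lt {i n : ℕ} {a : A} (ha : a ∈ 𝒜 i) (h : n < i) (b : A) :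
    proj 𝒜 n (a * b) = 0 := by
  rw [proj_apply, DirectSum.coe_decompose_mul_of_left_mem_of_not_le 𝒜 ha (by omega)]

theorem eq_zero_of_proj_eq_zero {a : A} (h : ∀ i, proj 𝒜 i a = 0) : a = 0 := by
  classical
  rw [← DirectSum.sum_support_decompose 𝒜 a]
  exact Finset.sum_eq_zero fun i _ => by rw [← proj_apply, h]

theorem eq_of_proj_eq {a b : A} (h : ∀ i, proj 𝒜 i a = proj 𝒜 i b) : a = b :=
  sub_eq_zero.mp (eq_zero_of_proj_eq_zero (𝒜 := 𝒜) fun i => by rw [map_sub, h, sub_self])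

theorem mem_of_proj_eq_zero {a : A} {i : ℕ} (h : ∀ j, j ≠ i → proj 𝒜 j a = 0) : a ∈ 𝒜 i := by
  have : a = proj 𝒜 i a := eq_of_proj_eq (𝒜 := 𝒜) fun j => by
    by_cases hj : j = i
    · rw [hj, proj_eq_self (proj_mem 𝒜 i a)]
    · rw [h j hj, proj_eq_zero (proj_mem 𝒜 i a) (Ne.symm hj)]
  rw [this]
  exact proj_mem 𝒜 i a

theorem sum_proj {N : ℕ} (hN : ∀ i, N ≤ i → 𝒜 i = ⊥) (a : A) :
    ∑ i ∈ Finset.range N, proj 𝒜 i a = a := by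
  refine eq_of_proj_eq (𝒜 := 𝒜) fun j => ?_
  rw [map_sum]
  by_cases hj : j < N
  · rw [Finset.sum_eq_single j, proj_eq_self (proj_mem 𝒜 j a)]
    · intro i _ hij
      exact proj_eq_zero (proj_mem 𝒜 i a) hij
    · intro h
      exact absurd (Finset.mem_range.mpr hj) h
  · have h0 : proj 𝒜 j a = 0 := by
      have := proj_mem 𝒜 j a
      rwa [hN j (by omega), Submodule.mem_bot] at this
    rw [h0]
    refine Finset.sum_eq_zero fun i hi => proj_eq_zero (proj_mem 𝒜 i a) ?_
    have := Finset.mem_range.mp hi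
    omega

variable (𝒜) in
/-- The ideal of elements all of whose components of degree `< n` vanish. -/
def truncationIdeal (n : ℕ) : Ideal A where
  carrier := {a | ∀ i < n, proj 𝒜 i a = 0}
  zero_mem' := fun i _ => map_zero _
  add_mem' := fun ha hb i hi => by rw [map_add, ha i hi, hb i hi, add_zero]
  smul_mem' := fun r a ha => by
    rw [smul_eq_mul]
    induction r using DirectSum.Decomposition.inductionOn 𝒜 with
    | zero => intro i _; rw [zero_mul, map_zero]
    | homogeneous r =>
      rename_i j
      intro i hi
      rcases le_or_gt j i with h | h
      · rw [proj_mul_of_le r.2 h, ha _ (by omega), mul_zero]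
      · exact proj_mul_of_lt r.2 h a
    | add r s hr hs => intro i hi; rw [add_mul, map_add, hr i hi, hs i hi, add_zero]

theorem mem_truncationIdeal {n : ℕ} {a : A} :
    a ∈ truncationIdeal 𝒜 n ↔ ∀ i < n, proj 𝒜 i a = 0 := Iff.rfl

theorem mem_truncationIdeal_of_mem {n i : ℕ} (h : n ≤ i) {a : A} (ha : a ∈ 𝒜 i) :
    a ∈ truncationIdeal 𝒜 n := fun j hj => proj_eq_zero ha (by omega)

omit [GradedAlgebra 𝒜] in
theorem mem_gradedMaximalIdeal_of_mem {i : ℕ} (hi : 0 < i) {a : A} (ha : a ∈ 𝒜 i) :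
    a ∈ gradedMaximalIdeal 𝒜 := Ideal.subset_span ⟨i, hi, ha⟩

theorem gradedMaximalIdeal_eq : gradedMaximalIdeal 𝒜 = truncationIdeal 𝒜 1 := by
  classical
  apply le_antisymm
  · refine Ideal.span_le.mpr ?_
    rintro a ⟨i, hi, ha⟩
    exact mem_truncationIdeal_of_mem hi ha
  · intro a ha
    rw [← DirectSum.sum_support_decompose 𝒜 a]
    refine sum_mem fun i _ => ?_
    rw [← proj_apply]
    rcases Nat.eq_zero_or_pos i with rfl | hi
    · rw [ha 0 one_pos]; exact zero_mem _
    · exact mem_gradedMaximalIdeal_of_mem hi (proj_mem 𝒜 i a)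

theorem mem_gradedMaximalIdeal {a : A} : a ∈ gradedMaximalIdeal 𝒜 ↔ proj 𝒜 0 a = 0 := by
  rw [gradedMaximalIdeal_eq, mem_truncationIdeal]
  exact ⟨fun h => h 0 one_pos, fun h i hi => by rwa [Nat.lt_one_iff.mp hi]⟩

theorem gradedMaximalIdeal_pow_le (n : ℕ) :
    gradedMaximalIdeal 𝒜 ^ n ≤ truncationIdeal 𝒜 n := by
  induction n with
  | zero => exact fun a _ i hi => absurd hi (Nat.not_lt_zero i)
  | succ n ih =>
    rw [pow_succ']
    refine Ideal.mul_le.mpr fun x hx y hy => ?_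
    have hle : gradedMaximalIdeal 𝒜 ≤
        Submodule.comap (LinearMap.mulRight A y) (truncationIdeal 𝒜 (n + 1)) := by
      refine Ideal.span_le.mpr ?_
      rintro a ⟨i, hi, ha⟩ l hl
      rw [LinearMap.mulRight_apply]
      rcases le_or_gt i l with h | h
      · rw [proj_mul_of_le ha h, ih hy _ (by omega), mul_zero]
      · exact proj_mul_of_lt ha h y
    exact hle hx

variable (𝒜) in
-- The truncation ideals form a descending chain. Once it is stationary, a homogeneous element of
-- degree `i` lies in the truncation ideal of level `i + 1`, so its only component vanishes.
theorem exists_forall_eq_bot [IsArtinianRing A] : ∃ N, ∀ i, N ≤ i → 𝒜 i = ⊥ := by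
  obtain ⟨N, hN⟩ := IsArtinian.monotone_stabilizes (R := A) (M := A)
    ⟨fun n => OrderDual.toDual (truncationIdeal 𝒜 n),
      fun m n hmn => OrderDual.toDual_le_toDual.mpr
        fun a ha i hi => ha i (lt_of_lt_of_le hi hmn)⟩
  refine ⟨N, fun i hi => (Submodule.eq_bot_iff _).mpr fun a ha => ?_⟩
  have h : truncationIdeal 𝒜 N = truncationIdeal 𝒜 (i + 1) := hN (i + 1) (by omega)
  have ha' := mem_truncationIdeal_of_mem hi ha
  rw [h] at ha'
  rw [← proj_eq_self ha]
  exact ha' i (Nat.lt_succ_self i)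

theorem truncationIdeal_eq_bot {N : ℕ} (hN : ∀ i, N ≤ i → 𝒜 i = ⊥) :
    truncationIdeal 𝒜 N = ⊥ := by
  refine (Submodule.eq_bot_iff _).mpr fun a ha => eq_zero_of_proj_eq_zero (𝒜 := 𝒜) fun i => ?_
  rcases lt_or_ge i N with h | h
  · exact ha i h
  · have := proj_mem 𝒜 i a
    rwa [hN i h, Submodule.mem_bot] at this

variable (𝒜) in
theorem isNilpotent_gradedMaximalIdeal [IsArtinianRing A] :
    IsNilpotent (gradedMaximalIdeal 𝒜) := by
  obtain ⟨N, hN⟩ := exists_forall_eq_bot 𝒜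
  exact ⟨N, le_bot_iff.mp ((gradedMaximalIdeal_pow_le N).trans (truncationIdeal_eq_bot hN).le)⟩

namespace IsStandardGraded

variable (hA : IsStandardGraded 𝒜)
include hA

omit [GradedAlgebra 𝒜] in
theorem algebraMap_mem (c : k) : algebraMap k A c ∈ 𝒜 0 := (hA.mem_zero_iff _).mpr ⟨c, rfl⟩

theorem exists_sub_mem (a : A) : ∃ c : k, a - algebraMap k A c ∈ gradedMaximalIdeal 𝒜 := by
  obtain ⟨c, hc⟩ := (hA.mem_zero_iff _).mp (proj_mem 𝒜 0 a)
  refine ⟨c, mem_gradedMaximalIdeal.mpr ?_⟩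
  rw [map_sub, proj_eq_self (hA.algebraMap_mem c), hc, sub_self]

theorem algebraMap_mem_iff {c : k} : algebraMap k A c ∈ gradedMaximalIdeal 𝒜 ↔ c = 0 := by
  rw [mem_gradedMaximalIdeal, proj_eq_self (hA.algebraMap_mem c),
    map_eq_zero_iff _ hA.algebraMap_injective]

omit [GradedAlgebra 𝒜] in
theorem nontrivial : Nontrivial A := hA.algebraMap_injective.nontrivial

theorem mem_socle [IsArtinianRing A] {z : A} :
    z ∈ socle A ↔ ∀ a ∈ gradedMaximalIdeal 𝒜, a * z = 0 :=
  mem_socle_iff (isNilpotent_gradedMaximalIdeal 𝒜) hA.exists_sub_mem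

theorem finite [IsArtinianRing A] : Module.Finite k A := by
  obtain ⟨N, hN⟩ := isNilpotent_gradedMaximalIdeal 𝒜
  have := fg_restrictScalars_of_pow_mul_eq_bot hA.exists_sub_mem N (⊤ : Ideal A)
    (by rw [hN]; exact zero_mul _)
  exact ⟨by simpa using this⟩

omit [GradedAlgebra 𝒜] in
/-- Modulo `𝔪²`, a standard graded algebra is `k ⊕ A₁`. -/
theorem exists_sub_mem_sq (a : A) : ∃ c : k, ∃ l ∈ 𝒜 1,
    a - algebraMap k A c - l ∈ gradedMaximalIdeal 𝒜 ^ 2 := by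
  have ha : a ∈ Algebra.adjoin k (𝒜 1 : Set A) := by rw [hA.adjoin_one]; trivial
  induction ha using Algebra.adjoin_induction with
  | mem x hx => exact ⟨0, x, hx, by rw [map_zero, sub_zero, sub_self]; exact zero_mem _⟩
  | algebraMap c => exact ⟨c, 0, zero_mem _, by rw [sub_self, sub_zero]; exact zero_mem _⟩
  | add x y _ _ hx hy =>
    obtain ⟨c, l, hl, h⟩ := hx
    obtain ⟨c', l', hl', h'⟩ := hy
    refine ⟨c + c', l + l', add_mem hl hl', ?_⟩
    convert add_mem h h' using 1
    rw [map_add]; ring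
  | mul x y _ _ hx hy =>
    obtain ⟨c, l, hl, h⟩ := hx
    obtain ⟨c', l', hl', h'⟩ := hy
    refine ⟨c * c', c • l' + c' • l,
      add_mem (Submodule.smul_mem _ _ hl') (Submodule.smul_mem _ _ hl), ?_⟩
    have hll : l * l' ∈ gradedMaximalIdeal 𝒜 ^ 2 := by
      rw [pow_two]
      exact Ideal.mul_mem_mul (mem_gradedMaximalIdeal_of_mem one_pos hl)
        (mem_gradedMaximalIdeal_of_mem one_pos hl')
    convert add_mem (add_mem (Ideal.mul_mem_right y _ h)
      (Ideal.mul_mem_left _ (algebraMap k A c + l) h')) hll using 1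
    rw [map_mul, Algebra.smul_def, Algebra.smul_def]; ring

/-- Elements of 𝔪² have no components in degrees 0 and 1, so comparing these components kills the
scalar and the linear part given by `exists_sub_mem_sq`. -/
theorem mem_sq_of_mem {i : ℕ} (hi : 2 ≤ i) {a : A} (ha : a ∈ 𝒜 i) :
    a ∈ gradedMaximalIdeal 𝒜 ^ 2 := by
  obtain ⟨c, l, hl, h⟩ := hA.exists_sub_mem_sq a
  have h' := gradedMaximalIdeal_pow_le 2 h
  have h0 := h' 0 (by norm_num)
  have h1 := h' 1 (by norm_num)
  rw [map_sub, map_sub, proj_eq_zero ha (by omega), proj_eq_self (hA.algebraMap_mem c),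
    proj_eq_zero hl (by norm_num), zero_sub, sub_zero, neg_eq_zero] at h0
  rw [map_sub, map_sub, proj_eq_zero ha (by omega), proj_eq_zero (hA.algebraMap_mem c)
    (by norm_num), proj_eq_self hl, sub_zero, zero_sub, neg_eq_zero] at h1
  rwa [h0, h1, sub_zero, sub_zero] at h

/-- The maximal ideal of a standard graded algebra is generated in degree one. -/
theorem gradedMaximalIdeal_le_span : gradedMaximalIdeal 𝒜 ≤ Ideal.span (𝒜 1 : Set A) := by
  have hsub : Ideal.span (𝒜 1 : Set A) ≤ gradedMaximalIdeal 𝒜 :=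
    Ideal.span_le.mpr fun x hx => mem_gradedMaximalIdeal_of_mem one_pos hx
  have key : ∀ a : A, ∃ c : k, a - algebraMap k A c ∈ Ideal.span (𝒜 1 : Set A) := fun a => by
    have ha : a ∈ Algebra.adjoin k (𝒜 1 : Set A) := by rw [hA.adjoin_one]; trivial
    induction ha using Algebra.adjoin_induction with
    | mem x hx => exact ⟨0, by rw [map_zero, sub_zero]; exact Ideal.subset_span hx⟩
    | algebraMap c => exact ⟨c, by rw [sub_self]; exact zero_mem _⟩
    | add x y _ _ hx hy =>
      obtain ⟨c, h⟩ := hx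
      obtain ⟨c', h'⟩ := hy
      refine ⟨c + c', ?_⟩
      convert add_mem h h' using 1
      rw [map_add]; ring
    | mul x y _ _ hx hy =>
      obtain ⟨c, h⟩ := hx
      obtain ⟨c', h'⟩ := hy
      refine ⟨c * c', ?_⟩
      convert add_mem (Ideal.mul_mem_right y _ h)
        (Ideal.mul_mem_left _ (algebraMap k A c) h') using 1
      rw [map_mul]; ring
  intro a ha
  obtain ⟨c, hc⟩ := key a
  have : algebraMap k A c ∈ gradedMaximalIdeal 𝒜 := by
    have := sub_mem ha (hsub hc)
    rwa [sub_sub_cancel] at this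
  rwa [hA.algebraMap_mem_iff.mp this, map_zero, sub_zero] at hc

end IsStandardGraded

section Map

variable {S : Type*} [CommRing S] [Algebra k S] {𝒮 : ℕ → Submodule k S} [GradedAlgebra 𝒮]
  {π : S →ₐ[k] A} (hgr : ∀ i : ℕ, ∀ s ∈ 𝒮 i, π s ∈ 𝒜 i)
include hgr

theorem map_proj_of_graded (i : ℕ) (s : S) : π (proj 𝒮 i s) = proj 𝒜 i (π s) := by
  induction s using DirectSum.Decomposition.inductionOn 𝒮 with
  | zero => simp
  | homogeneous s =>
    rename_i j
    by_cases hij : j = i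
    · subst hij
      rw [proj_eq_self s.2, proj_eq_self (hgr _ _ s.2)]
    · rw [proj_eq_zero s.2 hij, proj_eq_zero (hgr _ _ s.2) hij, map_zero]
  | add s t hs ht => rw [map_add, map_add, map_add, map_add, hs, ht]

theorem exists_mem_of_graded_surjective (hsurj : Function.Surjective π) {i : ℕ} {a : A}
    (ha : a ∈ 𝒜 i) : ∃ s ∈ 𝒮 i, π s = a := by
  obtain ⟨s, rfl⟩ := hsurj a
  exact ⟨proj 𝒮 i s, proj_mem 𝒮 i s, by rw [map_proj_of_graded hgr, proj_eq_self ha]⟩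

end Map

end Graded

/-! ### Nondegenerate functionals and self-injectivity. -/

section Frobenius

variable {k : Type u} {A : Type v} [Field k] [CommRing A] [Algebra k A] [Module.Finite k A]

/-- With respect to a nondegenerate functional `l`, every functional is of the form `l (c * ·)`. -/
theorem exists_functional_eq_mul (l : A →ₗ[k] k) (hl : ∀ a, (∀ b, l (a * b) = 0) → a = 0)
    (ψ : A →ₗ[k] k) : ∃ c, ∀ b, l (c * b) = ψ b := by
  let Φ : A →ₗ[k] Module.Dual k A := (LinearMap.mul k A).compr₂ l
  have hΦ : Function.Injective Φ := (injective_iff_map_eq_zero Φ).mpr fun a ha =>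
    hl a fun b => LinearMap.congr_fun ha b
  obtain ⟨c, hc⟩ := (LinearMap.injective_iff_surjective_of_finrank_eq_finrank
    (Subspace.dual_finrank_eq (K := k) (V := A)).symm).mp hΦ ψ
  exact ⟨c, fun b => LinearMap.congr_fun hc b⟩

/-- A finite-dimensional algebra with a nondegenerate functional is Gorenstein. -/
theorem IsArtinianGorenstein.of_nondegenerate (l : A →ₗ[k] k)
    (hl : ∀ a, (∀ b, l (a * b) = 0) → a = 0) : IsArtinianGorenstein A where
  artinian := IsArtinianRing.of_finite k A
  injective := by
    refine Module.Baer.injective fun I g => ?_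
    -- Baer's criterion: `l ∘ g` extends `k`-linearly from `I` to `A`, the extension is `l (c * ·)`,
    -- and nondegeneracy upgrades this to `g = c * ·` on `I`.
    obtain ⟨ψ, hψ⟩ := LinearMap.exists_extend (p := I.restrictScalars k)
      (l ∘ₗ g.restrictScalars k)
    obtain ⟨c, hc⟩ := exists_functional_eq_mul l hl ψ
    refine ⟨LinearMap.mulLeft A c, fun x hx => ?_⟩
    rw [LinearMap.mulLeft_apply]
    refine sub_eq_zero.mp (hl _ fun b => ?_)
    have h1 : ψ (x * b) = l (g ⟨x * b, I.mul_mem_right b hx⟩) :=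
      LinearMap.congr_fun hψ ⟨x * b, I.mul_mem_right b hx⟩
    have h2 : g ⟨x * b, I.mul_mem_right b hx⟩ = g ⟨x, hx⟩ * b := by
      rw [mul_comm (g _) b, ← smul_eq_mul b, ← map_smul]
      exact congrArg g (Subtype.ext (mul_comm x b))
    rw [sub_mul, map_sub, mul_assoc, hc, h1, h2, sub_self]

end Frobenius

/-! ### The canonical module and the kernel of a surjection ω → 𝔪. -/

section Canonical

variable {k : Type u} {R : Type v} [Field k] [CommRing R] [Algebra k R]

namespace CanonicalModule

/-- The canonical module as the `k`-linear dual. -/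
def toDual : CanonicalModule k R ≃ₗ[k] Module.Dual k R := LinearEquiv.refl k (Module.Dual k R)

theorem toDual_apply (φ : CanonicalModule k R) (x : R) : toDual φ x = φ x := rfl

theorem toDual_symm_apply (φ : Module.Dual k R) (x : R) : toDual.symm φ x = φ x := rfl

theorem map_smul' (φ : CanonicalModule k R) (c : k) (x : R) : φ (c • x) = c * φ x :=
  (toDual φ).map_smul c x

instance : IsScalarTower k R (CanonicalModule k R) :=
  ⟨fun c r φ => ext fun x => by
    rw [smul_apply, smul_mul_assoc, map_smul', coe_smul_apply, smul_apply]⟩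

instance [Module.Finite k R] : Module.Finite k (CanonicalModule k R) :=
  Module.Finite.equiv (toDual (k := k) (R := R)).symm

theorem finrank_eq : Module.finrank k (CanonicalModule k R) = Module.finrank k R :=
  (toDual (k := k) (R := R)).finrank_eq.trans Subspace.dual_finrank_eq

/-- The canonical module is faithful. -/
theorem eq_zero_of_forall_smul {r : R} (h : ∀ φ : CanonicalModule k R, r • φ = 0) : r = 0 := by
  refine (Module.forall_dual_apply_eq_zero_iff k r).mp fun φ => ?_
  have := congrArg (fun ψ : CanonicalModule k R => ψ 1) (h (toDual.symm φ))
  simpa only [smul_apply, mul_one, zero_apply, toDual_symm_apply] using this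

theorem eq_of_apply {φ ψ : CanonicalModule k R} {m : Ideal R}
    (hk : ∀ a : R, ∃ c : k, a - algebraMap k R c ∈ m) (h1 : φ 1 = ψ 1)
    (hm : ∀ r ∈ m, φ r = ψ r) : φ = ψ := by
  refine ext fun a => ?_
  obtain ⟨c, hc⟩ := hk a
  have ha : a = c • (1 : R) + (a - algebraMap k R c) := by
    rw [Algebra.smul_def, mul_one]; ring
  rw [ha, map_add', map_add', map_smul', map_smul', h1, hm _ hc]

end CanonicalModule

open GradedAlgebra CanonicalModule

variable {𝒜 : ℕ → Submodule k R} [GradedAlgebra 𝒜]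

/-- The projection `R → R₀ = k`, as an element of degree zero of the canonical module. -/
theorem IsStandardGraded.exists_augmentation (hR : IsStandardGraded 𝒜) :
    ∃ ε : CanonicalModule k R, ε ∈ canonicalGrading 𝒜 0 ∧ ε 1 = 1 ∧
      ∀ r, r ∈ gradedMaximalIdeal 𝒜 ↔ ε r = 0 := by
  have := hR.nontrivial
  obtain ⟨l, hl⟩ : ∃ l : Module.Dual k R, l 1 ≠ 0 := by
    by_contra! h
    exact one_ne_zero ((Module.forall_dual_apply_eq_zero_iff k (1 : R)).mp h)
  let ε : CanonicalModule k R := toDual.symm ((l 1)⁻¹ • (l ∘ₗ proj 𝒜 0))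
  have hε : ∀ a, ε a = (l 1)⁻¹ * l (proj 𝒜 0 a) := fun a => rfl
  have h0 : ∀ j : ℕ, j ≠ 0 → ∀ a ∈ 𝒜 j, ε a = 0 := fun j hj a ha => by
    rw [hε, proj_eq_zero ha hj, map_zero, mul_zero]
  have h1 : ε 1 = 1 := by
    rw [hε, proj_eq_self (SetLike.GradedOne.one_mem (A := 𝒜)), inv_mul_cancel₀ hl]
  have hm : ∀ r ∈ gradedMaximalIdeal 𝒜, ε r = 0 := fun r hr => by
    rw [hε, mem_gradedMaximalIdeal.mp hr, map_zero, mul_zero]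
  refine ⟨ε, fun j hj a ha => h0 j (by simpa using hj) a ha, h1, fun r => ⟨hm r, fun hr => ?_⟩⟩
  obtain ⟨c, hc⟩ := hR.exists_sub_mem r
  have hrc : r = c • (1 : R) + (r - algebraMap k R c) := by
    rw [Algebra.smul_def, mul_one]; ring
  have hc0 : c = 0 := by
    rw [hrc, map_add', map_smul', h1, hm _ hc] at hr
    simpa using hr
  rwa [hc0, map_zero, sub_zero] at hc

variable [IsArtinianRing R]

theorem IsStandardGraded.finrank_gradedMaximalIdeal_add_one (hR : IsStandardGraded 𝒜) :
    Module.finrank k (gradedMaximalIdeal 𝒜) + 1 = Module.finrank k R := by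
  have := hR.finite
  obtain ⟨ε, -, h1, hε⟩ := hR.exists_augmentation
  have hker : LinearMap.ker (toDual ε) = (gradedMaximalIdeal 𝒜).restrictScalars k := by
    ext r
    exact (hε r).symm
  have hdim := Module.Dual.finrank_ker_add_one_of_ne_zero (f := toDual ε)
    (fun h => one_ne_zero (h1.symm.trans (LinearMap.congr_fun h 1)))
  rw [hker] at hdim
  exact hdim

/-- The kernel of a surjection `ω → 𝔪` is annihilated by `𝔪`, being one-dimensional. -/
theorem smul_eq_zero_of_map_eq_zero (hR : IsStandardGraded 𝒜)
    {f : CanonicalModule k R →ₗ[R] gradedMaximalIdeal 𝒜} (hf : Function.Surjective f)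
    {x : CanonicalModule k R} (hx : f x = 0) {r : R} (hr : r ∈ gradedMaximalIdeal 𝒜) :
    r • x = 0 := by
  have := hR.finite
  have hrank := LinearMap.finrank_range_add_finrank_ker (f.restrictScalars k)
  rw [LinearMap.range_eq_top.mpr (show Function.Surjective (f.restrictScalars k) from hf),
    finrank_top, finrank_eq, ← hR.finrank_gradedMaximalIdeal_add_one] at hrank
  have hone : Module.finrank k (LinearMap.ker (f.restrictScalars k)) = 1 :=
    Nat.add_left_cancel hrank
  by_cases hx0 : x = 0
  · rw [hx0, smul_zero]
  let x' : LinearMap.ker (f.restrictScalars k) := ⟨x, hx⟩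
  have hx0' : x' ≠ 0 := fun h => hx0 (congrArg Subtype.val h)
  -- On the line ker f the element `r` acts by a scalar `c`; since `r` is nilpotent, `c = 0`.
  obtain ⟨c, hc⟩ := (finrank_eq_one_iff_of_nonzero' x' hx0').mp hone
    ⟨r • x, show f (r • x) = 0 by rw [map_smul, hx, smul_zero]⟩
  have hc : c • x = r • x := congrArg Subtype.val hc
  obtain ⟨N, hN⟩ := isNilpotent_gradedMaximalIdeal 𝒜
  have hpow : ∀ n : ℕ, r ^ n • x = c ^ n • x := fun n => by
    induction n with
    | zero => rw [pow_zero, pow_zero, one_smul, one_smul]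
    | succ n ih => rw [pow_succ', mul_smul, ih, smul_comm, ← hc, smul_smul, pow_succ]
  have hrN : r ^ N = 0 := by
    have := Ideal.pow_mem_pow hr N
    rwa [hN] at this
  have hcN := hpow N
  rw [hrN, zero_smul] at hcN
  have : c = 0 := eq_zero_of_pow_eq_zero ((smul_eq_zero.mp hcN.symm).resolve_right hx0)
  rw [← hc, this, zero_smul]

/-- The kernel of a surjection `ω → 𝔪` consists of the functionals vanishing on `𝔪`. -/
theorem map_eq_zero_iff_of_surjective (hR : IsStandardGraded 𝒜)
    {f : CanonicalModule k R →ₗ[R] gradedMaximalIdeal 𝒜} (hf : Function.Surjective f)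
    {x : CanonicalModule k R} : f x = 0 ↔ ∀ r ∈ gradedMaximalIdeal 𝒜, x r = 0 := by
  have hdir : ∀ x, f x = 0 → ∀ r ∈ gradedMaximalIdeal 𝒜, x r = 0 := fun x hx r hr => by
    have := congrArg (fun ψ : CanonicalModule k R => ψ 1)
      (smul_eq_zero_of_map_eq_zero hR hf hx hr)
    simpa only [CanonicalModule.smul_apply, mul_one, CanonicalModule.zero_apply] using this
  refine ⟨hdir x, fun hx => ?_⟩
  have := hR.finite
  -- The dimension count forces ker f ≠ 0. Both `z` and `x` vanish on 𝔪, hence are determined by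
  -- their values at 1, and `x` is a multiple of `z`.
  obtain ⟨z, hz, hz0⟩ : ∃ z, f z = 0 ∧ z ≠ 0 := by
    by_contra! h
    have hle := LinearMap.finrank_le_finrank_of_injective (f := f.restrictScalars k)
      ((injective_iff_map_eq_zero _).mpr fun z hz => h z hz)
    rw [finrank_eq, ← hR.finrank_gradedMaximalIdeal_add_one] at hle
    exact Nat.not_succ_le_self _ hle
  have hz1 : z 1 ≠ 0 := fun h => hz0 (CanonicalModule.eq_of_apply hR.exists_sub_mem
    (by rw [h, CanonicalModule.zero_apply])
    fun r hr => by rw [hdir z hz r hr, CanonicalModule.zero_apply])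
  have hxz : x = (x 1 * (z 1)⁻¹) • z := CanonicalModule.eq_of_apply hR.exists_sub_mem
    (by rw [coe_smul_apply, mul_assoc, inv_mul_cancel₀ hz1, mul_one])
    fun r hr => by rw [hx r hr, coe_smul_apply, hdir z hz r hr, mul_zero]
  rw [hxz]
  exact ((f.restrictScalars k).map_smul _ z).trans (by
    rw [LinearMap.restrictScalars_apply, hz, smul_zero])

end Canonical

/-! ### The symmetrized product on k ⊕ M. -/

section SymmetricExtension

variable {k R M : Type*} [Field k] [CommRing R] [AddCommGroup M] [Module R M]

/-- The underlying space `k ⊕ M` of the algebra attached to a linear map `g : M → R`. -/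
@[nolint unusedArguments]
def SymmetricExtension (k : Type*) {R M : Type*} [Field k] [CommRing R] [AddCommGroup M]
    [Module R M] (_ : M →ₗ[R] R) : Type _ :=
  k × M

namespace SymmetricExtension

/-- The commutation property of `g` which makes the symmetrized product associative. -/
class IsCommuting (g : M →ₗ[R] R) : Prop where
  smul_smul_comm : ∀ x y z : M, g y • g x • z = g y • g z • x

variable (g : M →ₗ[R] R)

instance : AddCommGroup (SymmetricExtension k g) := inferInstanceAs (AddCommGroup (k × M))

instance [Module k M] : Module k (SymmetricExtension k g) := inferInstanceAs (Module k (k × M))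

/-- The identification with `k ⊕ M`. -/
def equivProd [Module k M] : SymmetricExtension k g ≃ₗ[k] k × M := LinearEquiv.refl k (k × M)

variable {g}

/-- The component in `k`. -/
def fst (a : SymmetricExtension k g) : k := Prod.fst a

/-- The component in `M`. -/
def snd (a : SymmetricExtension k g) : M := Prod.snd a

variable (k g) in
/-- The inclusion of `M`. -/
def inr (x : M) : SymmetricExtension k g := ((0 : k), x)

theorem inr_fst (x : M) : (inr k g x).fst = 0 := rfl

theorem inr_snd (x : M) : (inr k g x).snd = x := rfl

@[ext]
theorem ext {a b : SymmetricExtension k g} (h₁ : a.fst = b.fst) (h₂ : a.snd = b.snd) : a = b :=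
  Prod.ext h₁ h₂

noncomputable instance [Module k M] : Mul (SymmetricExtension k g) where
  mul a b := (a.fst * b.fst,
    a.fst • b.snd + b.fst • a.snd + (2 : k)⁻¹ • (g b.snd • a.snd + g a.snd • b.snd))

instance : One (SymmetricExtension k g) where
  one := ((1 : k), (0 : M))

theorem mul_fst [Module k M] (a b : SymmetricExtension k g) : (a * b).fst = a.fst * b.fst := rfl

theorem mul_snd [Module k M] (a b : SymmetricExtension k g) :
    (a * b).snd = a.fst • b.snd + b.fst • a.snd +
      (2 : k)⁻¹ • (g b.snd • a.snd + g a.snd • b.snd) := rfl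

theorem one_fst : (1 : SymmetricExtension k g).fst = 1 := rfl

theorem one_snd : (1 : SymmetricExtension k g).snd = 0 := rfl

theorem add_fst (a b : SymmetricExtension k g) : (a + b).fst = a.fst + b.fst := rfl

theorem add_snd (a b : SymmetricExtension k g) : (a + b).snd = a.snd + b.snd := rfl

theorem zero_fst : (0 : SymmetricExtension k g).fst = 0 := rfl

theorem zero_snd : (0 : SymmetricExtension k g).snd = 0 := rfl

theorem smul_fst [Module k M] (c : k) (a : SymmetricExtension k g) : (c • a).fst = c * a.fst := rfl

theorem smul_snd [Module k M] (c : k) (a : SymmetricExtension k g) : (c • a).snd = c • a.snd := rfl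

theorem mul_comm' [Module k M] (a b : SymmetricExtension k g) : a * b = b * a :=
  ext (by rw [mul_fst, mul_fst, mul_comm]) (by
    rw [mul_snd, mul_snd, add_comm (a.fst • b.snd), add_comm (g b.snd • a.snd)])

theorem one_mul' [Module k M] (a : SymmetricExtension k g) : 1 * a = a :=
  ext (by rw [mul_fst, one_fst, one_mul]) (by
    rw [mul_snd, one_fst, one_snd, one_smul, smul_zero, smul_zero, map_zero, zero_smul, add_zero,
      add_zero, smul_zero, add_zero])

theorem inr_mul_inr [Module k M] (x y : M) : inr k g x * inr k g y =
    inr k g ((2 : k)⁻¹ • (g y • x + g x • y)) :=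
  ext (by rw [mul_fst, inr_fst, inr_fst, zero_mul]; rfl) (by
    rw [mul_snd, inr_fst, inr_fst, inr_snd, inr_snd, inr_snd, zero_smul, zero_smul, zero_add,
      zero_add])

variable [Algebra k R] [Module k M] [IsScalarTower k R M]

/-- Moves all scalars into `R`, so that `module` can work over a single ring. -/
theorem smul_eq_algebraMap_smul (c : k) (x : M) :
    c • x = algebraMap k R c • x := (algebraMap_smul R c x).symm

theorem mul_add' (a b c : SymmetricExtension k g) : a * (b + c) = a * b + a * c :=
  ext (by rw [add_fst, mul_fst, mul_fst, mul_fst, add_fst, mul_add]) (by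
    rw [add_snd, mul_snd, mul_snd, mul_snd, add_snd, add_fst]
    simp only [smul_eq_algebraMap_smul (R := R), map_add]
    module)

/-- Since `g` of a product on `M` is the product of the values, the two bracketings differ only by
(1/4)(g(x)g(y)z - g(y)g(z)x), which the commutation property kills. -/
theorem mul_assoc' [IsCommuting g] (a b c : SymmetricExtension k g) :
    a * b * c = a * (b * c) :=
  ext (by rw [mul_fst, mul_fst, mul_fst, mul_fst, mul_assoc]) (by
    rw [mul_snd, mul_snd, mul_snd, mul_snd, mul_fst, mul_fst]
    have key := IsCommuting.smul_smul_comm (g := g) a.snd b.snd c.snd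
    simp only [smul_eq_algebraMap_smul (R := R), map_add, map_mul, map_smul, smul_eq_mul]
    linear_combination (norm := module) (algebraMap k R 2⁻¹ ^ 2) • key)

variable (g) in
noncomputable instance [IsCommuting g] : CommRing (SymmetricExtension k g) :=
  { (inferInstance : AddCommGroup (SymmetricExtension k g)) with
    mul := (· * ·)
    one := 1
    mul_assoc := mul_assoc'
    mul_comm := mul_comm'
    one_mul := one_mul'
    mul_one := fun a => (mul_comm' a 1).trans (one_mul' a)
    left_distrib := mul_add'
    right_distrib := fun a b c => by
      rw [mul_comm' (a + b) c, mul_add', mul_comm' c a, mul_comm' c b]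
    zero_mul := fun a => by
      have := mul_add' a 0 0
      rw [add_zero, left_eq_add] at this
      rw [mul_comm', this]
    mul_zero := fun a => by
      have := mul_add' a 0 0
      rwa [add_zero, left_eq_add] at this }

theorem smul_mul' [IsCommuting g] (c : k) (a b : SymmetricExtension k g) :
    c • a * b = c • (a * b) :=
  ext (by rw [smul_fst, mul_fst, mul_fst, smul_fst, mul_assoc]) (by
    rw [smul_snd, mul_snd, mul_snd, smul_snd, smul_fst]
    simp only [smul_eq_algebraMap_smul (R := R), map_mul, map_smul, smul_eq_mul]
    module)

variable (g) in
noncomputable instance [IsCommuting g] : Algebra k (SymmetricExtension k g) :=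
  Algebra.ofModule smul_mul' fun c a b => by
    rw [mul_comm a (c • b), smul_mul', mul_comm]

theorem algebraMap_fst [IsCommuting g] (c : k) :
    (algebraMap k (SymmetricExtension k g) c).fst = c := by
  rw [Algebra.algebraMap_eq_smul_one, smul_fst, one_fst, mul_one]

theorem algebraMap_snd [IsCommuting g] (c : k) :
    (algebraMap k (SymmetricExtension k g) c).snd = 0 := by
  rw [Algebra.algebraMap_eq_smul_one, smul_snd, one_snd, smul_zero]

instance [Module.Finite k M] [IsCommuting g] : Module.Finite k (SymmetricExtension k g) :=
  Module.Finite.equiv (equivProd g).symm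

variable (g) in
/-- The algebra homomorphism `(α, x) ↦ α + g x`. -/
noncomputable def toBase [IsCommuting g] (h2 : (2 : k) ≠ 0) : SymmetricExtension k g →ₐ[k] R :=
  AlgHom.ofLinearMap
    ((Algebra.linearMap k R).coprod (g.restrictScalars k) ∘ₗ (equivProd g).toLinearMap)
    (show algebraMap k R 1 + g 0 = 1 by rw [map_one, map_zero, add_zero])
    (fun a b => by
      change algebraMap k R (a * b).fst + g (a * b).snd =
        (algebraMap k R a.fst + g a.snd) * (algebraMap k R b.fst + g b.snd)
      have h : algebraMap k R 2⁻¹ * 2 = 1 := by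
        rw [show (2 : R) = algebraMap k R 2 from (map_ofNat _ 2).symm, ← map_mul,
          inv_mul_cancel₀ h2, map_one]
      rw [mul_fst, mul_snd]
      simp only [smul_eq_algebraMap_smul (R := R), map_add, map_mul, map_smul, smul_eq_mul]
      linear_combination (g a.snd * g b.snd) * h)

theorem toBase_apply [IsCommuting g] (h2 : (2 : k) ≠ 0) (s : SymmetricExtension k g) :
    toBase g h2 s = algebraMap k R s.fst + g s.snd := rfl

end SymmetricExtension

end SymmetricExtension

/-! ### Gradings from finitely many projections. -/

section Decomposition

variable {k M : Type*} [Field k] [AddCommGroup M] [Module k M]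

/-- A family of submodules admitting finitely many compatible projections that sum up to the
identity decomposes the module. -/
@[reducible]
noncomputable def decompositionOfProjections (ℳ : ℕ → Submodule k M) (p : ℕ → M →ₗ[k] M) (N : ℕ)
    (hp : ∀ i x, p i x ∈ ℳ i) (hself : ∀ i, ∀ x ∈ ℳ i, p i x = x)
    (hne : ∀ i j, i ≠ j → ∀ x ∈ ℳ i, p j x = 0)
    (hsum : ∀ x, ∑ i ∈ Finset.range N, p i x = x) : DirectSum.Decomposition ℳ :=
  DirectSum.Decomposition.ofLinearMap ℳ
    (∑ i ∈ Finset.range N,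
      DirectSum.lof k ℕ (fun i => ℳ i) i ∘ₗ (p i).codRestrict (ℳ i) (hp i))
    (by
      ext x
      rw [LinearMap.comp_apply, LinearMap.sum_apply, map_sum, LinearMap.id_apply]
      conv_rhs => rw [← hsum x]
      refine Finset.sum_congr rfl fun i _ => ?_
      rw [LinearMap.comp_apply, DirectSum.coeLinearMap_lof, LinearMap.codRestrict_apply])
    (by
      refine DirectSum.linearMap_ext k fun i => LinearMap.ext fun x => ?_
      rw [LinearMap.comp_apply, LinearMap.comp_apply, DirectSum.coeLinearMap_lof,
        LinearMap.sum_apply, LinearMap.comp_apply, LinearMap.id_apply]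
      have hz : ∀ j, i ≠ j → (p j).codRestrict (ℳ j) (hp j) (x : M) = 0 := fun j hij =>
        Subtype.ext (hne i j hij x x.2)
      by_cases hi : i ∈ Finset.range N
      · rw [Finset.sum_eq_single i, LinearMap.comp_apply]
        · congr 1
          exact Subtype.ext (hself i x x.2)
        · intro j _ hj
          rw [LinearMap.comp_apply, hz j hj.symm, map_zero]
        · exact fun h => absurd hi h
      · have hx : x = 0 := Subtype.ext (by
          rw [← hsum (x : M)]
          exact Finset.sum_eq_zero fun j hj =>
            hne i j (fun h => hi (h ▸ hj)) x x.2)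
        rw [hx, map_zero]
        exact Finset.sum_eq_zero fun j _ => by
          rw [ZeroMemClass.coe_zero, map_zero])

end Decomposition

/-! ### The grading of the canonical module. -/

section CanonicalProjection

open GradedAlgebra CanonicalModule

variable {k : Type u} {R : Type v} [Field k] [CommRing R] [Algebra k R]
  (𝒜 : ℕ → Submodule k R) [GradedAlgebra 𝒜]

/-- The projection of the canonical module onto its component of degree `-j`. -/
noncomputable def canonicalProj (j : ℕ) : CanonicalModule k R →ₗ[k] CanonicalModule k R :=
  toDual.symm.toLinearMap ∘ₗ (proj 𝒜 j).dualMap ∘ₗ toDual.toLinearMap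

variable {𝒜}

theorem canonicalProj_apply (j : ℕ) (x : CanonicalModule k R) (a : R) :
    canonicalProj 𝒜 j x a = x (proj 𝒜 j a) := rfl

theorem canonicalProj_mem (j : ℕ) (x : CanonicalModule k R) :
    canonicalProj 𝒜 j x ∈ canonicalGrading 𝒜 (-j) := fun i hi a ha => by
  rw [canonicalProj_apply, proj_eq_zero ha (by simpa using hi), map_zero']

theorem canonicalProj_eq_zero {j : ℕ} {i : ℤ} (hij : i ≠ -j) {x : CanonicalModule k R}
    (hx : x ∈ canonicalGrading 𝒜 i) : canonicalProj 𝒜 j x = 0 :=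
  CanonicalModule.ext fun a => by
    rw [canonicalProj_apply, CanonicalModule.zero_apply]
    exact hx j (by omega) _ (proj_mem 𝒜 j a)

theorem canonicalProj_eq_self {j : ℕ} {x : CanonicalModule k R}
    (hx : x ∈ canonicalGrading 𝒜 (-j)) : canonicalProj 𝒜 j x = x :=
  CanonicalModule.ext fun a => by
    rw [canonicalProj_apply]
    induction a using DirectSum.Decomposition.inductionOn 𝒜 with
    | zero => rw [map_zero]
    | homogeneous a =>
      rename_i i
      by_cases hij : i = j
      · subst hij
        rw [proj_eq_self a.2]
      · rw [proj_eq_zero a.2 hij, map_zero', hx i (by omega) a a.2]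
    | add a b ha hb => rw [map_add, map_add', map_add', ha, hb]

theorem sum_canonicalProj {N : ℕ} (hN : ∀ i, N ≤ i → 𝒜 i = ⊥) (x : CanonicalModule k R) :
    ∑ j ∈ Finset.range N, canonicalProj 𝒜 j x = x :=
  CanonicalModule.ext fun a => by
    have h : (∑ j ∈ Finset.range N, canonicalProj 𝒜 j x) a =
        ∑ j ∈ Finset.range N, canonicalProj 𝒜 j x a := by
      rw [← toDual_apply, map_sum, LinearMap.sum_apply]
      rfl
    rw [h]
    conv_rhs => rw [← sum_proj hN a, ← toDual_apply, map_sum]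
    rfl

theorem eq_zero_of_mem_canonicalGrading {i : ℤ} (h : ∀ j : ℕ, (j : ℤ) = -i → 𝒜 j = ⊥)
    {x : CanonicalModule k R} (hx : x ∈ canonicalGrading 𝒜 i) : x = 0 :=
  CanonicalModule.ext fun a => by
    rw [CanonicalModule.zero_apply]
    induction a using DirectSum.Decomposition.inductionOn 𝒜 with
    | zero => rw [map_zero']
    | homogeneous a =>
      rename_i j
      by_cases hij : (j : ℤ) = -i
      · rw [show (a : R) = 0 from (Submodule.eq_bot_iff _).mp (h j hij) a a.2, map_zero']
      · exact hx j hij a a.2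
    | add a b ha hb => rw [map_add', ha, hb, add_zero]

theorem smul_mem_canonicalGrading {i : ℤ} {j : ℕ} {r : R} (hr : r ∈ 𝒜 j)
    {x : CanonicalModule k R} (hx : x ∈ canonicalGrading 𝒜 i) :
    r • x ∈ canonicalGrading 𝒜 (i + j) := fun l hl a ha => by
  rw [CanonicalModule.smul_apply]
  exact hx (j + l) (by push_cast; omega) _ (SetLike.GradedMul.mul_mem hr ha)

end CanonicalProjection

/-! ### The algebra k ⊕ ω(-d): grading, map to R, socle, self-injectivity. -/

section Cover

open GradedAlgebra CanonicalModule SymmetricExtension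

variable {k : Type u} {R : Type v} [Field k] [CommRing R] [Algebra k R]
  {𝒜 : ℕ → Submodule k R}

/-- The map `ω → 𝔪`, regarded as a map `ω → R`. -/
noncomputable abbrev toRing (f : CanonicalModule k R →ₗ[R] gradedMaximalIdeal 𝒜) :
    CanonicalModule k R →ₗ[R] R := (gradedMaximalIdeal 𝒜).subtype ∘ₗ f

/-- The grading of `k ⊕ ω(t)`. -/
def coverGrading (𝒜 : ℕ → Submodule k R) (g : CanonicalModule k R →ₗ[R] R) (t : ℤ) (i : ℕ) :
    Submodule k (SymmetricExtension k g) where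
  carrier := {s | (i ≠ 0 → s.fst = 0) ∧ s.snd ∈ canonicalGrading 𝒜 (t + i)}
  zero_mem' := ⟨fun _ => zero_fst, zero_mem _⟩
  add_mem' := fun ha hb => ⟨fun hi => by rw [add_fst, ha.1 hi, hb.1 hi, add_zero],
    add_mem ha.2 hb.2⟩
  smul_mem' := fun c s hs => ⟨fun hi => by rw [smul_fst, hs.1 hi, mul_zero],
    Submodule.smul_mem _ c hs.2⟩

theorem mem_coverGrading {g : CanonicalModule k R →ₗ[R] R} {t : ℤ} {i : ℕ}
    {s : SymmetricExtension k g} : s ∈ coverGrading 𝒜 g t i ↔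
      (i ≠ 0 → s.fst = 0) ∧ s.snd ∈ canonicalGrading 𝒜 (t + i) := Iff.rfl

variable [GradedAlgebra 𝒜]

variable (𝒜) in
/-- The projection of `k ⊕ ω(-d)` onto its component of degree `i`. -/
noncomputable def coverProj (g : CanonicalModule k R →ₗ[R] R) (d i : ℕ) :
    SymmetricExtension k g →ₗ[k] SymmetricExtension k g :=
  (equivProd g).symm.toLinearMap ∘ₗ LinearMap.prodMap
    -- Degree `i` of ω(-d) is the dual of `R` in degree `d - i`. The test `i ≤ d` guards against
    -- truncated subtraction: beyond `d` the component is zero.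
    (if i = 0 then LinearMap.id else 0) (if i ≤ d then canonicalProj 𝒜 (d - i) else 0) ∘ₗ
    (equivProd g).toLinearMap

theorem coverProj_fst {g : CanonicalModule k R →ₗ[R] R} (d i : ℕ) (s : SymmetricExtension k g) :
    (coverProj 𝒜 g d i s).fst = if i = 0 then s.fst else 0 := by
  change (if i = 0 then LinearMap.id else 0 : k →ₗ[k] k) s.fst = _
  split_ifs <;> rfl

theorem coverProj_snd {g : CanonicalModule k R →ₗ[R] R} (d i : ℕ) (s : SymmetricExtension k g) :
    (coverProj 𝒜 g d i s).snd = if i ≤ d then canonicalProj 𝒜 (d - i) s.snd else 0 := by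
  change (if i ≤ d then canonicalProj 𝒜 (d - i) else 0 :
    CanonicalModule k R →ₗ[k] CanonicalModule k R) s.snd = _
  split_ifs <;> rfl

/-- The decomposition of `k ⊕ ω(-d)` into its homogeneous components. -/
@[reducible]
noncomputable def coverDecomposition (g : CanonicalModule k R →ₗ[R] R) {d : ℕ}
    (hbot : ∀ i, d ≤ i → 𝒜 i = ⊥) : DirectSum.Decomposition (coverGrading 𝒜 g (-d)) :=
  decompositionOfProjections _ (coverProj 𝒜 g d) (d + 1)
    (fun i s => by
      rw [mem_coverGrading, coverProj_fst, coverProj_snd]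
      refine ⟨fun hi => if_neg hi, ?_⟩
      split_ifs with h
      · have := canonicalProj_mem (𝒜 := 𝒜) (d - i) s.snd
        rwa [Nat.cast_sub h, neg_sub, sub_eq_neg_add] at this
      · exact zero_mem _)
    (fun i s hs => by
      rw [mem_coverGrading] at hs
      refine SymmetricExtension.ext ?_ ?_
      · rw [coverProj_fst]
        split_ifs with h
        · rfl
        · exact (hs.1 h).symm
      · rw [coverProj_snd]
        split_ifs with h
        · refine canonicalProj_eq_self ?_
          rw [Nat.cast_sub h, neg_sub, sub_eq_neg_add]
          exact hs.2
        · exact (eq_zero_of_mem_canonicalGrading (fun j hj => by omega) hs.2).symm)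
    (fun i j hij s hs => by
      rw [mem_coverGrading] at hs
      refine SymmetricExtension.ext ?_ ?_
      · rw [coverProj_fst, zero_fst]
        split_ifs with h
        · exact hs.1 (by omega)
        · rfl
      · rw [coverProj_snd, zero_snd]
        split_ifs with h
        · exact canonicalProj_eq_zero (by omega) hs.2
        · rfl)
    (fun s => by
      have hfst : ∀ (t : Finset ℕ) (p : ℕ → SymmetricExtension k g),
          (∑ i ∈ t, p i).fst = ∑ i ∈ t, (p i).fst := fun t p =>
        map_sum (LinearMap.fst k k (CanonicalModule k R) ∘ₗ (equivProd g).toLinearMap) p t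
      have hsnd : ∀ (t : Finset ℕ) (p : ℕ → SymmetricExtension k g),
          (∑ i ∈ t, p i).snd = ∑ i ∈ t, (p i).snd := fun t p =>
        map_sum (LinearMap.snd k k (CanonicalModule k R) ∘ₗ (equivProd g).toLinearMap) p t
      refine SymmetricExtension.ext ?_ ?_
      · rw [hfst, Finset.sum_eq_single 0]
        · rw [coverProj_fst, if_pos rfl]
        · intro i _ hi
          rw [coverProj_fst, if_neg hi]
        · intro h
          exact absurd (Finset.mem_range.mpr (Nat.succ_pos d)) h
      · rw [hsnd]
        -- The reflection `i ↦ d - i` matches degrees of ω(-d) with degrees of `R`.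
        have h := Finset.sum_range_reflect (fun j => canonicalProj 𝒜 j s.snd) (d + 1)
        rw [sum_canonicalProj (fun i hi => hbot i (by omega)) s.snd] at h
        conv_rhs => rw [← h]
        refine Finset.sum_congr rfl fun i hi => ?_
        have hi := Finset.mem_range.mp hi
        rw [coverProj_snd, if_pos (by omega)]
        rfl)

variable {f : CanonicalModule k R →ₗ[R] gradedMaximalIdeal 𝒜} {d : ℕ}

/-- The graded algebra structure of `k ⊕ ω(-d)`. -/
@[reducible]
noncomputable def coverGradedAlgebra [IsCommuting (toRing f)]
    (hf : IsGradedSurjection 𝒜 (-d) f) (hbot : ∀ i, d ≤ i → 𝒜 i = ⊥) :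
    GradedAlgebra (coverGrading 𝒜 (toRing f) (-d)) :=
  { coverDecomposition (toRing f) hbot with
    one_mem := ⟨fun h => absurd rfl h, by rw [one_snd]; exact zero_mem _⟩
    mul_mem := fun i j a b ha hb => by
      have hsc : ∀ {i j : ℕ} {a b : SymmetricExtension k (toRing f)},
          a ∈ coverGrading 𝒜 (toRing f) (-d) i → b ∈ coverGrading 𝒜 (toRing f) (-d) j →
          a.fst • b.snd ∈ canonicalGrading 𝒜 (-d + (i + j : ℕ)) := by
        intro i j a b ha hb
        by_cases hi : i = 0
        · subst hi
          rw [zero_add]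
          exact Submodule.smul_mem _ _ hb.2
        · rw [ha.1 hi, zero_smul]
          exact zero_mem _
      have hpr : ∀ {i j : ℕ} {a b : SymmetricExtension k (toRing f)},
          a ∈ coverGrading 𝒜 (toRing f) (-d) i → b ∈ coverGrading 𝒜 (toRing f) (-d) j →
          toRing f b.snd • a.snd ∈ canonicalGrading 𝒜 (-d + (i + j : ℕ)) := by
        intro i j a b ha hb
        have hj : toRing f b.snd ∈ 𝒜 j := hf.degree_zero j _ hb.2
        have := smul_mem_canonicalGrading hj ha.2
        rwa [add_assoc, ← Nat.cast_add] at this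
      refine ⟨fun hij => ?_, ?_⟩
      · rw [mul_fst]
        by_cases hi : i = 0
        · rw [hb.1 (by omega), mul_zero]
        · rw [ha.1 hi, zero_mul]
      · rw [mul_snd]
        refine add_mem (add_mem (hsc ha hb) ?_) (Submodule.smul_mem _ _ (add_mem (hpr ha hb) ?_))
        · rw [add_comm i j]
          exact hsc hb ha
        · rw [add_comm i j]
          exact hpr hb ha }

/-- The values of `f` lie in 𝔪, which meets `k` only in 0, so the two summands of the image vanish
separately. -/
theorem toBase_eq_zero_iff [IsCommuting (toRing f)] (hR : IsStandardGraded 𝒜) (h2 : (2 : k) ≠ 0)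
    {s : SymmetricExtension k (toRing f)} :
    toBase (toRing f) h2 s = 0 ↔ s.fst = 0 ∧ toRing f s.snd = 0 := by
  rw [toBase_apply]
  constructor
  · intro h
    have hmem : algebraMap k R s.fst ∈ gradedMaximalIdeal 𝒜 := by
      rw [eq_neg_of_add_eq_zero_left h]
      exact neg_mem (f s.snd).2
    have h0 := hR.algebraMap_mem_iff.mp hmem
    rw [h0, map_zero, zero_add] at h
    exact ⟨h0, h⟩
  · rintro ⟨h0, h1⟩
    rw [h0, h1, map_zero, add_zero]

theorem toBase_mem_iff [IsCommuting (toRing f)] (hR : IsStandardGraded 𝒜) (h2 : (2 : k) ≠ 0)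
    {s : SymmetricExtension k (toRing f)} :
    toBase (toRing f) h2 s ∈ gradedMaximalIdeal 𝒜 ↔ s.fst = 0 := by
  rw [toBase_apply, Ideal.add_mem_iff_left _ (show toRing f s.snd ∈ _ from (f s.snd).2),
    hR.algebraMap_mem_iff]

theorem toBase_surjective [IsCommuting (toRing f)] (hR : IsStandardGraded 𝒜)
    (hf : Function.Surjective f) (h2 : (2 : k) ≠ 0) :
    Function.Surjective (toBase (toRing f) h2) := fun r => by
  obtain ⟨c, hc⟩ := hR.exists_sub_mem r
  obtain ⟨x, hx⟩ := hf ⟨_, hc⟩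
  refine ⟨algebraMap k _ c + inr k _ x, ?_⟩
  have hx : toRing f x = r - algebraMap k R c := congrArg Subtype.val hx
  rw [map_add, AlgHom.commutes, toBase_apply, inr_fst, inr_snd, map_zero, zero_add, hx,
    add_sub_cancel]

variable [IsArtinianRing R]

/-- By commutativity of `R`, f(x)z - f(z)x lies in ker f, which 𝔪, hence f(y), annihilates. -/
theorem isCommuting_toRing (hR : IsStandardGraded 𝒜) (hf : Function.Surjective f) :
    IsCommuting (toRing f) where
  smul_smul_comm x y z := by
    rw [← sub_eq_zero, ← smul_sub]
    refine smul_eq_zero_of_map_eq_zero hR hf (Subtype.ext ?_) (f y).2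
    change toRing f (toRing f x • z - toRing f z • x) = 0
    rw [map_sub, map_smul, map_smul, smul_eq_mul, smul_eq_mul, mul_comm, sub_self]

theorem toRing_eq_zero_iff (hR : IsStandardGraded 𝒜) (hf : Function.Surjective f)
    {x : CanonicalModule k R} : toRing f x = 0 ↔ ∀ r ∈ gradedMaximalIdeal 𝒜, x r = 0 := by
  rw [← map_eq_zero_iff_of_surjective hR hf]
  exact ⟨fun h => Subtype.ext h, fun h => congrArg Subtype.val h⟩

/-- Elements of the kernel of `k ⊕ ω → R` annihilate the maximal ideal. -/
theorem mul_eq_zero_of_toBase_eq_zero [IsCommuting (toRing f)] (hR : IsStandardGraded 𝒜)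
    (hf : Function.Surjective f) (h2 : (2 : k) ≠ 0) {a s : SymmetricExtension k (toRing f)}
    (ha : a.fst = 0) (hs : toBase (toRing f) h2 s = 0) : a * s = 0 := by
  obtain ⟨h0, h1⟩ := (toBase_eq_zero_iff hR h2).mp hs
  refine SymmetricExtension.ext ?_ ?_
  · rw [mul_fst, ha, zero_mul, zero_fst]
  · have h3 : toRing f a.snd • s.snd = 0 :=
      smul_eq_zero_of_map_eq_zero hR hf (Subtype.ext h1) (f a.snd).2
    rw [mul_snd, ha, h0, h1, h3, zero_smul, zero_smul, zero_smul, add_zero, smul_zero, add_zero,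
      zero_snd]

variable (hR : IsStandardGraded 𝒜) (hf : Function.Surjective f) (h2 : (2 : k) ≠ 0)
  (hrad : ∀ x, (∀ y, toRing f y • x + toRing f x • y = 0) → toRing f x = 0)
include hR hf h2 hrad

/-- The ideal where the scalar component vanishes is nilpotent with residue field `k`, so the socle
is its annihilator. Testing against ε kills the scalar component of a socle element; what remains
says that its ω-component is in the radical of the form. -/
theorem socle_cover [IsCommuting (toRing f)] :
    socle (SymmetricExtension k (toRing f)) = RingHom.ker (toBase (toRing f) h2) := by
  let n : Ideal (SymmetricExtension k (toRing f)) :=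
    (gradedMaximalIdeal 𝒜).comap (toBase (toRing f) h2)
  have hmem : ∀ {s}, s ∈ n ↔ s.fst = 0 := toBase_mem_iff hR h2
  have hnil : IsNilpotent n := by
    obtain ⟨N, hN⟩ := isNilpotent_gradedMaximalIdeal 𝒜
    -- `n ^ N` maps to 𝔪^N = 0, hence lies in the kernel of the map to `R`; one further factor from
    -- `n` kills that kernel.
    refine ⟨N + 1, le_bot_iff.mp ?_⟩
    rw [pow_succ']
    refine Ideal.mul_le.mpr fun a ha s hs => ?_
    have hs : toBase (toRing f) h2 s ∈ gradedMaximalIdeal 𝒜 ^ N := Ideal.le_comap_pow _ N hs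
    rw [hN] at hs
    exact mul_eq_zero_of_toBase_eq_zero hR hf h2 (hmem.mp ha) hs
  ext s
  rw [mem_socle_iff (k := k) hnil (fun a => ⟨a.fst, hmem.mpr ?_⟩), RingHom.mem_ker]
  · refine ⟨fun h => ?_, fun h a ha => mul_eq_zero_of_toBase_eq_zero hR hf h2 (hmem.mp ha) h⟩
    have hy : ∀ y, s.fst • y + (2 : k)⁻¹ • (toRing f s.snd • y + toRing f y • s.snd) = 0 :=
        fun y => by
      have := congrArg SymmetricExtension.snd (h (inr k _ y) (hmem.mpr (inr_fst y)))
      rwa [mul_snd, inr_fst, inr_snd, zero_smul, zero_add, zero_snd] at this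
    obtain ⟨ε, -, h1, hε⟩ := hR.exists_augmentation
    have hε0 : toRing f ε = 0 :=
      (toRing_eq_zero_iff hR hf).mpr fun r hr => (hε r).mp hr
    have hs0 : s.fst = 0 := by
      have h3 := hy ε
      have h4 : toRing f s.snd • ε = 0 :=
        smul_eq_zero_of_map_eq_zero hR hf (Subtype.ext hε0) (f s.snd).2
      rw [hε0, zero_smul, h4, add_zero, smul_zero, add_zero] at h3
      have := congrArg (fun φ : CanonicalModule k R => φ 1) h3
      simpa only [coe_smul_apply, h1, mul_one, CanonicalModule.zero_apply] using this
    refine (toBase_eq_zero_iff hR h2).mpr ⟨hs0, hrad _ fun y => ?_⟩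
    have h3 := hy y
    rw [hs0, zero_smul, zero_add] at h3
    rw [add_comm]
    exact (smul_eq_zero.mp h3).resolve_left (inv_ne_zero h2)
  · change a.fst - (algebraMap k (SymmetricExtension k (toRing f)) a.fst).fst = 0
    rw [algebraMap_fst, sub_self]

/-- Evaluation of the ω-component at 1 is a nondegenerate functional: pairing with ε detects the
scalar component, pairing with 1 detects the value at 1, and pairing with ω puts the ω-component in
the radical, so that it vanishes on 𝔪. -/
theorem isArtinianGorenstein_cover [IsCommuting (toRing f)] :
    IsArtinianGorenstein (SymmetricExtension k (toRing f)) := by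
  have := hR.finite
  obtain ⟨ε, -, h1, hε⟩ := hR.exists_augmentation
  have hε0 : toRing f ε = 0 := (toRing_eq_zero_iff hR hf).mpr fun r hr => (hε r).mp hr
  let l : SymmetricExtension k (toRing f) →ₗ[k] k :=
    { toFun := fun s => s.snd 1
      map_add' := fun _ _ => rfl
      map_smul' := fun _ _ => rfl }
  have hl : ∀ a b, l (a * b) = a.fst * b.snd 1 + b.fst * a.snd 1 +
      2⁻¹ * (a.snd (toRing f b.snd) + b.snd (toRing f a.snd)) := fun a b => by
    change (a * b).snd 1 = _
    simp only [mul_snd, CanonicalModule.add_apply, coe_smul_apply, CanonicalModule.smul_apply,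
      mul_one]
  refine IsArtinianGorenstein.of_nondegenerate l fun a ha => ?_
  have ha0 : a.fst = 0 := by
    have h3 := hl a (inr k _ ε)
    rw [ha, inr_fst, inr_snd, hε0, map_zero', h1, (hε (toRing f a.snd)).mp (f a.snd).2] at h3
    simpa using h3.symm
  have ha1 : a.snd 1 = 0 := by
    have h3 := hl a 1
    rw [ha, one_fst, one_snd, map_zero, map_zero', CanonicalModule.zero_apply,
      CanonicalModule.zero_apply] at h3
    simpa using h3.symm
  have hker : toRing f a.snd = 0 := hrad _ fun y => CanonicalModule.ext fun r => by
    -- Replacing `y` by `r • y` turns evaluation at 1 into evaluation at `r`, so the whole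
    -- functional vanishes.
    have h3 := hl a (inr k _ (r • y))
    rw [ha, inr_fst, inr_snd, ha0, zero_mul, zero_mul, zero_add, zero_add, map_smul, smul_eq_mul,
      CanonicalModule.smul_apply] at h3
    rw [CanonicalModule.add_apply, CanonicalModule.smul_apply, CanonicalModule.smul_apply,
      CanonicalModule.zero_apply, mul_comm _ r, mul_comm _ r]
    exact (mul_eq_zero.mp h3.symm).resolve_left (inv_ne_zero h2)
  refine SymmetricExtension.ext ha0
    (CanonicalModule.eq_of_apply hR.exists_sub_mem ha1 fun r hr => ?_)
  rw [(toRing_eq_zero_iff hR hf).mp hker r hr]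
  rfl

end Cover

/-! ### Generation of the cover in degree one, and the radical condition. -/

section CoverStandard

open GradedAlgebra CanonicalModule SymmetricExtension

variable {k : Type u} {R : Type v} [Field k] [CommRing R] [Algebra k R]
  {𝒜 : ℕ → Submodule k R}
  {f : CanonicalModule k R →ₗ[R] gradedMaximalIdeal 𝒜} {d : ℕ}

theorem toBase_mem_of_mem [IsCommuting (toRing f)] (hR : IsStandardGraded 𝒜)
    (hf : IsGradedSurjection 𝒜 (-d) f) (h2 : (2 : k) ≠ 0) (i : ℕ)
    (s : SymmetricExtension k (toRing f)) (hs : s ∈ coverGrading 𝒜 (toRing f) (-d) i) :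
    toBase (toRing f) h2 s ∈ 𝒜 i := by
  rw [toBase_apply]
  refine add_mem ?_ (hf.degree_zero i _ hs.2)
  by_cases hi : i = 0
  · rw [hi]
    exact hR.algebraMap_mem _
  · rw [hs.1 hi, map_zero]
    exact zero_mem _

variable [GradedAlgebra 𝒜] [IsArtinianRing R]

/-- The subalgebra `B` generated in degree one maps onto `R`, whose kernel in the cover is kε, so it
suffices that ε lies in `B`. Products of elements of the maximal ideal depend only on their images
in `R` and hence lie in `B`; some such product is a nonzero multiple of ε. -/
theorem isStandardGraded_cover [IsCommuting (toRing f)] (hR : IsStandardGraded 𝒜)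
    (hf : IsGradedSurjection 𝒜 (-d) f) (h2 : (2 : k) ≠ 0) (hbot : ∀ i, d ≤ i → 𝒜 i = ⊥)
    (hrad : ∀ x, (∀ y, toRing f y • x + toRing f x • y = 0) → toRing f x = 0)
    (hd : gradedMaximalIdeal 𝒜 = ⊥ → d = 1) :
    IsStandardGraded (coverGrading 𝒜 (toRing f) (-d)) := by
  let _ := coverGradedAlgebra hf hbot
  refine ⟨fun c c' h => ?_, fun a => ⟨fun ha => ⟨a.fst, ?_⟩, ?_⟩, ?_⟩
  · have := congrArg SymmetricExtension.fst h
    rwa [algebraMap_fst, algebraMap_fst] at this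
  · refine SymmetricExtension.ext (algebraMap_fst _) ?_
    rw [algebraMap_snd]
    -- Degree 0 of ω(-d) is dual to `R` in degree `d`; this is where vanishing at `d` itself is
    -- needed.
    exact (eq_zero_of_mem_canonicalGrading (fun j hj => hbot j (by simp at hj; omega)) ha.2).symm
  · rintro ⟨c, rfl⟩
    refine ⟨fun h => absurd rfl h, ?_⟩
    rw [algebraMap_snd]
    exact zero_mem _
  set π := toBase (toRing f) h2 with hπ
  set B := Algebra.adjoin k
    (coverGrading 𝒜 (toRing f) (-d) 1 : Set (SymmetricExtension k (toRing f))) with hB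
  have hlift : ∀ s, ∃ b ∈ B, π b = π s := fun s => by
    have hmap : B.map π = ⊤ := by
      rw [hB, AlgHom.map_adjoin, eq_top_iff, ← hR.adjoin_one]
      refine Algebra.adjoin_mono fun a ha => ?_
      obtain ⟨s, hs, hsa⟩ := exists_mem_of_graded_surjective (toBase_mem_of_mem hR hf h2)
        (toBase_surjective hR hf.surjective h2) ha
      exact ⟨s, hs, hsa⟩
    have : π s ∈ B.map π := by rw [hmap]; trivial
    exact this
  have hprod : ∀ a b : SymmetricExtension k (toRing f), a.fst = 0 → b.fst = 0 → a * b ∈ B := by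
    intro a b ha hb
    obtain ⟨a', ha'B, ha'⟩ := hlift a
    obtain ⟨b', hb'B, hb'⟩ := hlift b
    have ha'0 : a'.fst = 0 := by
      rw [← toBase_mem_iff hR h2, ← hπ, ha', hπ, toBase_mem_iff hR h2, ha]
    have h1 : a' * (b - b') = 0 := mul_eq_zero_of_toBase_eq_zero hR hf.surjective h2 ha'0
      (by rw [← hπ, map_sub, hb', sub_self])
    have h3 : b * (a - a') = 0 := mul_eq_zero_of_toBase_eq_zero hR hf.surjective h2 hb
      (by rw [← hπ, map_sub, ha', sub_self])
    have : a * b = a' * b' := by linear_combination h1 + h3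
    rw [this]
    exact mul_mem ha'B hb'B
  obtain ⟨ε, hεgr, h1, hε⟩ := hR.exists_augmentation
  have hspan : ∀ w, toRing f w = 0 → w = w 1 • ε := fun w hw =>
    CanonicalModule.eq_of_apply hR.exists_sub_mem (by rw [coe_smul_apply, h1, mul_one])
      fun r hr => by
        rw [(toRing_eq_zero_iff hR hf.surjective).mp hw r hr, coe_smul_apply, (hε r).mp hr,
          mul_zero]
  have hinr : ∀ (c : k) (x : CanonicalModule k R),
      inr k (toRing f) (c • x) = c • inr k (toRing f) x := fun c x =>
    SymmetricExtension.ext (by rw [smul_fst, inr_fst, inr_fst, mul_zero]) rfl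
  have hsoc : inr k (toRing f) ε ∈ B := by
    by_cases hm : gradedMaximalIdeal 𝒜 = ⊥
    -- ε has degree `d` in the cover; for 𝔪 = 0 there is no product to use, but `d = 1` makes it a
    -- generator.
    · refine Algebra.subset_adjoin ⟨fun _ => inr_fst ε, ?_⟩
      rw [hd hm]
      simpa [inr_snd] using hεgr
    -- Lift a nonzero socle element `r` of 𝔪 to `x`. By the radical condition some product of `x`
    -- with `y` is nonzero, and `f` kills it because 𝔪 kills `r`.
    · obtain ⟨r, hrm, hr0, hr⟩ :=
        exists_mem_ne_zero_of_isNilpotent (isNilpotent_gradedMaximalIdeal 𝒜) hm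
      obtain ⟨x, hx⟩ := hf.surjective ⟨r, hrm⟩
      have hx : toRing f x = r := congrArg Subtype.val hx
      obtain ⟨y, hy⟩ : ∃ y, toRing f y • x + toRing f x • y ≠ 0 := by
        by_contra! h
        exact hr0 (hx.symm.trans (hrad x h))
      set w := toRing f y • x + toRing f x • y with hw
      have hw0 : toRing f w = 0 := by
        have : toRing f y * r = 0 := hr _ (f y).2
        rw [hw, map_add, map_smul, map_smul, hx, smul_eq_mul, smul_eq_mul, mul_comm r, this,
          add_zero]
      have hw1 : w 1 ≠ 0 := fun h => hy (by rw [hspan w hw0, h, zero_smul])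
      have hmem := hprod _ _ (inr_fst (k := k) (g := toRing f) x) (inr_fst y)
      rw [inr_mul_inr, ← hw, hspan w hw0, hinr, hinr] at hmem
      have := B.smul_mem (B.smul_mem hmem 2) (w 1)⁻¹
      rwa [smul_inv_smul₀ h2, inv_smul_smul₀ hw1] at this
  rw [eq_top_iff]
  rintro s -
  obtain ⟨b, hb, hbs⟩ := hlift s
  have hker : π (s - b) = 0 := by rw [map_sub, hbs, sub_self]
  obtain ⟨h3, h4⟩ := (toBase_eq_zero_iff hR h2).mp hker
  have hs : s = b + (s - b).snd 1 • inr k (toRing f) ε := by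
    rw [← hinr, ← hspan _ h4]
    have : s - b = inr k (toRing f) (s - b).snd := SymmetricExtension.ext h3 rfl
    rw [← this, add_sub_cancel]
  rw [hs]
  exact add_mem hb (B.smul_mem hsoc _)

/-- If the symmetric form `(x, y) ↦ f(y) x + f(x) y` has no radical outside the kernel of
`f : ω(-d) → 𝔪`, then `k ⊕ ω(-d)` is a Gorenstein algebra with quotient `R` by its socle. -/
theorem exists_gorenstein_cover (hR : IsStandardGraded 𝒜) (hf : IsGradedSurjection 𝒜 (-d) f)
    (h2 : (2 : k) ≠ 0) (hbot : ∀ i, d ≤ i → 𝒜 i = ⊥)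
    (hrad : ∀ x, (∀ y, toRing f y • x + toRing f x • y = 0) → toRing f x = 0)
    (hd : gradedMaximalIdeal 𝒜 = ⊥ → d = 1) :
    ∃ (S : Type (max u v)) (_ : CommRing S) (_ : Algebra k S)
      (𝒮 : ℕ → Submodule k S) (_ : GradedAlgebra 𝒮) (π : S →ₐ[k] R)
      (e : S ≃ₗ[k] k × CanonicalModule k R),
      e 1 = (1, 0) ∧
      (∀ a b : S, e (a * b) =
        ((e a).1 * (e b).1,
          (e a).1 • (e b).2 + (e b).1 • (e a).2 +
            (2 : k)⁻¹ • ((f (e b).2 : R) • (e a).2 + (f (e a).2 : R) • (e b).2))) ∧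
      (∀ (i : ℕ) (s : S), s ∈ 𝒮 i ↔
        (i ≠ 0 → (e s).1 = 0) ∧ (e s).2 ∈ canonicalGrading 𝒜 (-d + i)) ∧
      (∀ s : S, π s = algebraMap k R (e s).1 + (f (e s).2 : R)) ∧
      IsGorensteinModSocle 𝒮 𝒜 π := by
  have := isCommuting_toRing hR hf.surjective
  refine ⟨SymmetricExtension k (toRing f), inferInstance, inferInstance,
    coverGrading 𝒜 (toRing f) (-d), coverGradedAlgebra hf hbot, toBase (toRing f) h2,
    equivProd (toRing f), rfl, fun a b => rfl, fun i s => Iff.rfl, fun s => rfl, ?_⟩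
  exact
    { standard := isStandardGraded_cover hR hf h2 hbot hrad hd
      gorenstein := isArtinianGorenstein_cover hR hf.surjective h2 hrad
      surjective := toBase_surjective hR hf.surjective h2
      graded := toBase_mem_of_mem hR hf h2
      ker_eq := (socle_cover hR hf.surjective h2 hrad).symm }

/-- If the socle lies in `𝔪²`, the form `(x, y) ↦ f(y) x + f(x) y` has no radical outside the
kernel of `f`. -/
theorem toRing_eq_zero_of_socle_le (hR : IsStandardGraded 𝒜) (hf : Function.Surjective f)
    (h2 : (2 : k) ≠ 0) (hsoc : socle R ≤ gradedMaximalIdeal 𝒜 ^ 2) (x : CanonicalModule k R)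
    (hx : ∀ y, toRing f y • x + toRing f x • y = 0) : toRing f x = 0 := by
  have hcancel : ∀ {M : Type (max u v)} [AddCommGroup M] [Module k M] {m : M}, m + m = 0 → m = 0 :=
    fun {M} _ _ {m} h => by
      rw [← two_smul k] at h
      exact (smul_eq_zero.mp h).resolve_left h2
  have hcancel' : ∀ r : R, r + r = 0 → r = 0 := fun r h => by
    rw [← two_smul k] at h
    exact (smul_eq_zero.mp h).resolve_left h2
  have hmem : toRing f x ∈ gradedMaximalIdeal 𝒜 ^ 2 := by
    -- Applying `f` to the radical relation gives 2f(y)f(x) = 0 with f(y) arbitrary in 𝔪.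
    refine hsoc (hR.mem_socle.mpr fun a ha => ?_)
    obtain ⟨y, hy⟩ := hf ⟨a, ha⟩
    have hy : toRing f y = a := congrArg Subtype.val hy
    have := congrArg (toRing f) (hx y)
    rw [map_add, map_smul, map_smul, map_zero, smul_eq_mul, smul_eq_mul, hy,
      mul_comm (toRing f x)] at this
    exact hcancel' _ this
  have hcomm := isCommuting_toRing hR hf
  -- For s = ab the lift is `a • w` with f(w) = b: writing a = f(v), the commutation rule swaps `y`
  -- and `w`.
  have key : ∀ s ∈ gradedMaximalIdeal 𝒜 ^ 2, ∃ x', toRing f x' = s ∧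
      ∀ y, toRing f y • x' = s • y := fun s hs => by
    rw [pow_two] at hs
    induction hs using Submodule.mul_induction_on' with
    | mem_mul_mem a ha b hb =>
      obtain ⟨v, hv⟩ := hf ⟨a, ha⟩
      have hv : toRing f v = a := congrArg Subtype.val hv
      obtain ⟨w, hw⟩ := hf ⟨b, hb⟩
      have hw : toRing f w = b := congrArg Subtype.val hw
      refine ⟨a • w, by rw [map_smul, hw, smul_eq_mul], fun y => ?_⟩
      rw [smul_comm, ← hv, hcomm.smul_smul_comm, hw, smul_smul]
    | add s _ t _ hs ht =>
      obtain ⟨x₁, h₁, h₁'⟩ := hs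
      obtain ⟨x₂, h₂, h₂'⟩ := ht
      exact ⟨x₁ + x₂, by rw [map_add, h₁, h₂], fun y => by rw [smul_add, h₁', h₂', add_smul]⟩
  obtain ⟨x', hx', hx''⟩ := key _ hmem
  refine eq_zero_of_forall_smul (k := k) fun y => hcancel ?_
  have hdiff : toRing f y • (x - x') = 0 :=
    smul_eq_zero_of_map_eq_zero hR hf (Subtype.ext (by
      change toRing f (x - x') = 0
      rw [map_sub, hx', sub_self])) (f y).2
  rw [smul_sub, sub_eq_zero, hx''] at hdiff
  have := hx y
  rwa [hdiff] at this

/-- A graded surjection `ω(t) → 𝔪 ≠ 0` forces `-t` to exceed all degrees of `R`. -/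
theorem eq_bot_of_isGradedSurjection (hR : IsStandardGraded 𝒜) {t : ℤ}
    (hf : IsGradedSurjection 𝒜 t f) (hm : gradedMaximalIdeal 𝒜 ≠ ⊥) {j : ℕ} (hj : -t ≤ j) :
    𝒜 j = ⊥ := by
  have hpos : ∀ j : ℕ, 0 < j → -t ≤ j → 𝒜 j = ⊥ := fun j hj0 hj => by
    refine (Submodule.eq_bot_iff _).mpr fun a ha => ?_
    refine (Module.forall_dual_apply_eq_zero_iff k a).mp fun φ => ?_
    have hgr := canonicalProj_mem (𝒜 := 𝒜) j (toDual.symm φ)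
    -- The dual of `R` in degree `j` sits in degree -j - t ≤ 0 of ω(t), where 𝔪 is zero. So `f`
    -- kills these functionals, and they must vanish on 𝔪.
    have hdeg := hf.degree_zero (-j - t) (canonicalProj 𝒜 j (toDual.symm φ))
      (by rwa [add_sub_cancel])
    have hzero : toRing f (canonicalProj 𝒜 j (toDual.symm φ)) = 0 := by
      rcases hi : -(j : ℤ) - t with n | n
      · have hn : n = 0 := by
          have : (-(j : ℤ) - t) = n := hi
          omega
        subst hn
        rw [hi] at hdeg
        have hdeg : toRing f (canonicalProj 𝒜 j (toDual.symm φ)) ∈ 𝒜 0 := hdeg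
        rw [← proj_eq_self hdeg]
        exact mem_gradedMaximalIdeal.mp (f _).2
      · rw [hi] at hdeg
        exact hdeg
    have := (toRing_eq_zero_iff hR hf.surjective).mp hzero a
      (mem_gradedMaximalIdeal_of_mem hj0 ha)
    rwa [canonicalProj_apply, proj_eq_self ha] at this
  rcases Nat.eq_zero_or_pos j with rfl | hj0
  · refine absurd (le_bot_iff.mp (Ideal.span_le.mpr ?_)) hm
    rintro a ⟨i, hi, ha⟩
    rw [hpos i hi (by push_cast at hj; omega)] at ha
    exact ha
  · exact hpos j hj0 hj

end CoverStandard

/-! ### The case 𝔪² = 0. -/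

section SquareZero

open GradedAlgebra CanonicalModule MvPolynomial

variable {k : Type u} {R : Type v} [Field k] [CommRing R] [Algebra k R]
  {𝒜 : ℕ → Submodule k R}

theorem MvPolynomial.IsHomogeneous.degree_eq_of_mem_support {σ : Type*} {p : MvPolynomial σ k}
    {i : ℕ} (hp : p.IsHomogeneous i) {x : σ →₀ ℕ} (hx : x ∈ p.support) : x.degree = i := by
  by_contra h
  exact mem_support_iff.mp hx (hp.coeff_eq_zero h)

theorem IsPolynomialModSquare.eq_bot (h : IsPolynomialModSquare 𝒜) {i : ℕ} (hi : 2 ≤ i) :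
    𝒜 i = ⊥ := by
  obtain ⟨n, e, he⟩ := h
  refine (Submodule.eq_bot_iff _).mpr fun a ha => ?_
  obtain ⟨p, hp, hpa⟩ := (he i a).mp ha
  have hmem : p ∈ idealOfVars (Fin n) k ^ 2 := by
    refine (mem_pow_idealOfVars_iff 2 p).mpr fun x hx => ?_
    rwa [hp.degree_eq_of_mem_support hx]
  rw [Ideal.Quotient.eq_zero_iff_mem.mpr hmem] at hpa
  exact e.map_eq_zero_iff.mp hpa.symm

/-- Modulo the square of the ideal of the variables, every polynomial is affine linear. -/
theorem exists_sub_mem_idealOfVars_sq {n : ℕ} (p : MvPolynomial (Fin n) k) :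
    ∃ (c : k) (a : Fin n → k), p - C c - ∑ i, a i • X i ∈ idealOfVars (Fin n) k ^ 2 := by
  have hX : ∀ i, (X i : MvPolynomial (Fin n) k) ∈ idealOfVars (Fin n) k := fun i =>
    Ideal.subset_span ⟨i, rfl⟩
  induction p using MvPolynomial.induction_on with
  | C c => exact ⟨c, 0, by simp⟩
  | add p q hp hq =>
    obtain ⟨c, a, h⟩ := hp
    obtain ⟨c', a', h'⟩ := hq
    refine ⟨c + c', a + a', ?_⟩
    convert add_mem h h' using 1
    simp only [map_add, Pi.add_apply, add_smul, Finset.sum_add_distrib]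
    ring
  | mul_X p i hp =>
    obtain ⟨c, a, h⟩ := hp
    refine ⟨0, Pi.single i c, ?_⟩
    have hsum : ∑ j, (Pi.single i c : Fin n → k) j • (X j : MvPolynomial (Fin n) k) =
        C c * X i := by
      rw [Finset.sum_eq_single i]
      · rw [Pi.single_eq_same, smul_eq_C_mul]
      · intro j _ hj
        rw [Pi.single_eq_of_ne hj, zero_smul]
      · exact fun h => absurd (Finset.mem_univ i) h
    have hquad : (∑ j, a j • (X j : MvPolynomial (Fin n) k)) * X i ∈ idealOfVars (Fin n) k ^ 2 := by
      rw [pow_two]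
      refine Ideal.mul_mem_mul (sum_mem fun j _ => ?_) (hX i)
      rw [smul_eq_C_mul]
      exact Ideal.mul_mem_left _ _ (hX j)
    convert add_mem (Ideal.mul_mem_right (X i) _ h) hquad using 1
    rw [hsum, map_zero]
    ring

variable [GradedAlgebra 𝒜]

theorem gradedMaximalIdeal_sq_eq_bot (hbot : ∀ i, 2 ≤ i → 𝒜 i = ⊥) :
    gradedMaximalIdeal 𝒜 ^ 2 = ⊥ :=
  le_bot_iff.mp ((gradedMaximalIdeal_pow_le 2).trans (truncationIdeal_eq_bot hbot).le)

theorem aeval_mem_of_isHomogeneous {n : ℕ} {b : Fin n → R} (hb : ∀ i, b i ∈ 𝒜 1) {i : ℕ}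
    {p : MvPolynomial (Fin n) k} (hp : p.IsHomogeneous i) : aeval b p ∈ 𝒜 i := by
  rw [aeval_def, eval₂_eq']
  refine sum_mem fun x hx => ?_
  rw [← Algebra.smul_def]
  refine Submodule.smul_mem _ _ ?_
  have := SetLike.prod_pow_mem_graded 𝒜 (fun _ => 1) b x (F := Finset.univ) fun j _ => hb j
  convert this using 1
  rw [← hp.degree_eq_of_mem_support hx]
  simp [Finsupp.degree_eq_sum]

/-- Send the variables to a basis of `R₁`. Modulo the square of the variables a polynomial is affine
linear, and linear independence of 1 and the basis shows that nothing else is in the kernel. -/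
theorem IsStandardGraded.isPolynomialModSquare [IsArtinianRing R] (hR : IsStandardGraded 𝒜)
    (hbot : ∀ i, 2 ≤ i → 𝒜 i = ⊥) : IsPolynomialModSquare 𝒜 := by
  have := hR.finite
  let b := Module.finBasis k (𝒜 1)
  let φ : MvPolynomial (Fin (Module.finrank k (𝒜 1))) k →ₐ[k] R := aeval fun i => (b i : R)
  have hsum : ∀ a : Fin (Module.finrank k (𝒜 1)) → k,
      φ (∑ i, a i • X i) = ((∑ i, a i • b i : 𝒜 1) : R) := fun a => by
    rw [map_sum, AddSubmonoidClass.coe_finsetSum]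
    refine Finset.sum_congr rfl fun i _ => ?_
    rw [map_smul, aeval_X]
    rfl
  have hlin : ∀ (l : R) (hl : l ∈ 𝒜 1), φ (∑ i, b.repr ⟨l, hl⟩ i • X i) = l := fun l hl => by
    rw [hsum, b.sum_repr]
  have hsurj : Function.Surjective φ := fun r => by
    obtain ⟨c, l, hl, h⟩ := hR.exists_sub_mem_sq r
    rw [gradedMaximalIdeal_sq_eq_bot hbot, Submodule.mem_bot] at h
    refine ⟨C c + ∑ i, b.repr ⟨l, hl⟩ i • X i, ?_⟩
    rw [map_add, hlin l hl, algHom_C]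
    linear_combination -h
  have hzero : ∀ p ∈ idealOfVars (Fin (Module.finrank k (𝒜 1))) k ^ 2, φ p = 0 := fun p hp => by
    have hle : idealOfVars (Fin (Module.finrank k (𝒜 1))) k ≤ (gradedMaximalIdeal 𝒜).comap φ := by
      refine Ideal.span_le.mpr ?_
      rintro _ ⟨i, rfl⟩
      change φ (X i) ∈ gradedMaximalIdeal 𝒜
      rw [aeval_X]
      exact mem_gradedMaximalIdeal_of_mem one_pos (b i).2
    have h : φ p ∈ gradedMaximalIdeal 𝒜 ^ 2 :=
      Ideal.le_comap_pow φ 2 (Ideal.pow_right_mono hle 2 hp)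
    rwa [gradedMaximalIdeal_sq_eq_bot hbot] at h
  have hker : RingHom.ker φ = idealOfVars (Fin (Module.finrank k (𝒜 1))) k ^ 2 := by
    ext p
    refine ⟨fun hp => ?_, hzero p⟩
    obtain ⟨c, a, h⟩ := exists_sub_mem_idealOfVars_sq p
    have h0 := hzero _ h
    rw [map_sub, map_sub, show φ p = 0 from hp, algHom_C, hsum] at h0
    have hc := congrArg (proj 𝒜 0) h0
    rw [map_sub, map_sub, map_zero, proj_eq_self (hR.algebraMap_mem c),
      proj_eq_zero (SetLike.coe_mem _) one_ne_zero, zero_sub, sub_zero, neg_eq_zero,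
      map_eq_zero_iff _ hR.algebraMap_injective] at hc
    rw [hc, map_zero, sub_zero, zero_sub, neg_eq_zero] at h0
    have ha : ∀ i, a i = 0 := Fintype.linearIndependent_iff.mp b.linearIndependent a
      (Subtype.ext h0)
    rw [hc, map_zero, sub_zero, Finset.sum_eq_zero (fun i _ => by rw [ha, zero_smul]),
      sub_zero] at h
    exact h
  let e := ((Ideal.quotientEquivAlgOfEq k hker.symm).trans
    (Ideal.quotientKerAlgEquivOfSurjective hsurj)).symm
  have he : ∀ p a, Ideal.Quotient.mk _ p = e a ↔ φ p = a := fun p a => by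
    rw [eq_comm, ← AlgEquiv.eq_symm_apply, eq_comm]
    rfl
  refine ⟨_, e, fun i a => ⟨fun ha => ?_, ?_⟩⟩
  · obtain rfl | rfl | hi : i = 0 ∨ i = 1 ∨ 2 ≤ i := by omega
    · obtain ⟨c, rfl⟩ := (hR.mem_zero_iff a).mp ha
      exact ⟨C c, isHomogeneous_C _ c, (he _ _).mpr (algHom_C φ c)⟩
    · refine ⟨_, ?_, (he _ _).mpr (hlin a ha)⟩
      refine IsHomogeneous.sum _ _ _ fun j _ => ?_
      rw [smul_eq_C_mul]
      exact (isHomogeneous_X k j).C_mul _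
    · rw [hbot i hi, Submodule.mem_bot] at ha
      exact ⟨0, isHomogeneous_zero _ _ _, (he _ _).mpr (by rw [map_zero, ha])⟩
  · rintro ⟨p, hp, hpa⟩
    rw [← (he _ _).mp hpa]
    exact aeval_mem_of_isHomogeneous (fun i => (b i).2) hp

/-- The standard quadratic form makes an algebra with `𝔪² = 0` a Gorenstein algebra modulo its
socle. -/
theorem exists_gorenstein_cover_of_eq_bot [IsArtinianRing R] (hR : IsStandardGraded 𝒜)
    (h2 : (2 : k) ≠ 0) (hbot : ∀ i, 2 ≤ i → 𝒜 i = ⊥) :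
    ∃ (S : Type (max u v)) (_ : CommRing S) (_ : Algebra k S)
      (𝒮 : ℕ → Submodule k S) (_ : GradedAlgebra 𝒮) (π : S →ₐ[k] R),
      IsGorensteinModSocle 𝒮 𝒜 π := by
  have := hR.finite
  -- Here Soc(R) is not contained in 𝔪² = 0, so the radical condition has to be verified for a
  -- specific `f`.
  suffices h : ∃ (d : ℕ) (f : CanonicalModule k R →ₗ[R] gradedMaximalIdeal 𝒜),
      IsGradedSurjection 𝒜 (-d) f ∧ (∀ i, d ≤ i → 𝒜 i = ⊥) ∧
      (∀ x, (∀ y, toRing f y • x + toRing f x • y = 0) → toRing f x = 0) ∧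
      (gradedMaximalIdeal 𝒜 = ⊥ → d = 1) by
    obtain ⟨d, f, hf, hd, hrad, hm⟩ := h
    obtain ⟨S, i₁, i₂, 𝒮, i₃, π, e, -, -, -, -, h⟩ := exists_gorenstein_cover hR hf h2 hd hrad hm
    exact ⟨S, i₁, i₂, 𝒮, i₃, π, h⟩
  by_cases hm : gradedMaximalIdeal 𝒜 = ⊥
  -- For R = k the cover is k[ε]/(ε²) with ε in degree one.
  · refine ⟨1, 0, ⟨fun x => ⟨0, Subtype.ext ?_⟩, fun i x _ => zero_mem _⟩, fun i hi => ?_,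
      fun x _ => rfl, fun _ => rfl⟩
    · have hx := x.2
      rw [LinearMap.zero_apply, ZeroMemClass.coe_zero]
      exact ((Submodule.eq_bot_iff _).mp hm x hx).symm
    · refine (Submodule.eq_bot_iff _).mpr fun a ha => ?_
      exact (Submodule.eq_bot_iff _).mp hm a (mem_gradedMaximalIdeal_of_mem hi ha)
  let b := Module.finBasis k (𝒜 1)
  have hmul : ∀ (r : R) (c : k), r - algebraMap k R c ∈ gradedMaximalIdeal 𝒜 →
      ∀ l ∈ gradedMaximalIdeal 𝒜, r * l = c • l := fun r c hc l hl => by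
    have h : (r - algebraMap k R c) * l ∈ gradedMaximalIdeal 𝒜 ^ 2 := by
      rw [pow_two]
      exact Ideal.mul_mem_mul hc hl
    rw [gradedMaximalIdeal_sq_eq_bot hbot, Submodule.mem_bot, sub_mul, sub_eq_zero] at h
    rw [h, Algebra.smul_def]
  have hbm : ∀ i, (b i : R) ∈ gradedMaximalIdeal 𝒜 := fun i =>
    mem_gradedMaximalIdeal_of_mem one_pos (b i).2
  let f : CanonicalModule k R →ₗ[R] gradedMaximalIdeal 𝒜 :=
    { toFun := fun x => ⟨∑ i, x (b i) • (b i : R), sum_mem fun i _ =>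
        Submodule.smul_of_tower_mem _ _ (hbm i)⟩
      map_add' := fun x y => Subtype.ext (by
        simp only [CanonicalModule.add_apply, add_smul, Finset.sum_add_distrib,
          Submodule.coe_add])
      map_smul' := fun r x => Subtype.ext (by
        obtain ⟨c, hc⟩ := hR.exists_sub_mem r
        simp only [RingHom.id_apply, SetLike.val_smul, smul_eq_mul, Finset.mul_sum]
        refine Finset.sum_congr rfl fun i _ => ?_
        rw [CanonicalModule.smul_apply, hmul r c hc _ (hbm i), mul_smul_comm,
          hmul r c hc _ (hbm i), map_smul', smul_smul, mul_comm]) }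
  have hf : ∀ x, toRing f x = ((∑ i, x (b i) • b i : 𝒜 1) : R) := fun x => by
    rw [AddSubmonoidClass.coe_finsetSum]
    rfl
  have hdual : ∀ c : Fin (Module.finrank k (𝒜 1)) → k, ∃ x : CanonicalModule k R,
      ∀ i, x (b i) = c i := fun c => by
    obtain ⟨ψ, hψ⟩ := LinearMap.exists_extend (b.constr k c)
    refine ⟨toDual.symm ψ, fun i => ?_⟩
    exact (LinearMap.congr_fun hψ (b i)).trans (b.constr_basis k c i)
  refine ⟨2, f, ⟨fun r => ?_, fun i x hx => ?_⟩, hbot, fun x hx => ?_, fun h => absurd h hm⟩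
  · obtain ⟨c, l, hl, h⟩ := hR.exists_sub_mem_sq r
    rw [gradedMaximalIdeal_sq_eq_bot hbot, Submodule.mem_bot] at h
    have hc : c = 0 := hR.algebraMap_mem_iff.mp (by
      rw [show algebraMap k R c = r - l by linear_combination -h]
      exact sub_mem r.2 (mem_gradedMaximalIdeal_of_mem one_pos hl))
    obtain ⟨x, hx⟩ := hdual (b.repr ⟨l, hl⟩)
    refine ⟨x, Subtype.ext ((hf x).trans ?_)⟩
    simp only [hx, b.sum_repr]
    rw [hc, map_zero] at h
    linear_combination -h
  · change toRing f x ∈ _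
    by_cases hi : i = 1
    · subst hi
      rw [hf]
      exact SetLike.coe_mem _
    · have hz : ∀ j, x (b j) = 0 := fun j => hx 1 (by push_cast; omega) _ (b j).2
      rw [hf, Finset.sum_eq_zero (fun j _ => by rw [hz, zero_smul])]
      exact zero_mem _
  · have hz : ∀ j, x (b j) = 0 := fun j => by
      -- With `y` dual to `b j`, the radical relation evaluated at 1 reads 2x(b j) = 0.
      obtain ⟨y, hy⟩ := hdual (Pi.single j 1)
      have hfy : toRing f y = b j := by
        rw [hf, Finset.sum_eq_single j]
        · rw [hy, Pi.single_eq_same, one_smul]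
        · intro i _ hij
          rw [hy, Pi.single_eq_of_ne hij, zero_smul]
        · exact fun h => absurd (Finset.mem_univ j) h
      have hyx : y (toRing f x) = x (b j) := by
        have : y (toRing f x) = ∑ i, x (b i) * y (b i) := by
          rw [hf, AddSubmonoidClass.coe_finsetSum, ← toDual_apply, map_sum]
          exact Finset.sum_congr rfl fun i _ => map_smul' y _ _
        rw [this, Finset.sum_eq_single j]
        · rw [hy, Pi.single_eq_same, mul_one]
        · intro i _ hij
          rw [hy, Pi.single_eq_of_ne hij, mul_zero]
        · exact fun h => absurd (Finset.mem_univ j) h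
      have h3 := congrArg (fun φ : CanonicalModule k R => φ 1) (hx y)
      simp only [CanonicalModule.add_apply, CanonicalModule.smul_apply, mul_one,
        CanonicalModule.zero_apply] at h3
      rw [hyx, hfy, ← two_mul] at h3
      exact (mul_eq_zero.mp h3).resolve_left h2
    rw [hf, Finset.sum_eq_zero (fun j _ => by rw [hz, zero_smul])]
    rfl

end SquareZero

universe w

/-! ### From a Gorenstein algebra to its quotient by the socle. -/

section Gorenstein

open GradedAlgebra CanonicalModule

variable {k : Type u} [Field k] {S : Type w} [CommRing S] [Algebra k S]
  {𝒮 : ℕ → Submodule k S} [GradedAlgebra 𝒮]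

/-- The top degree of an Artinian standard graded algebra. -/
theorem IsStandardGraded.exists_top_degree [IsArtinianRing S] (hS : IsStandardGraded 𝒮) :
    ∃ d, 𝒮 d ≠ ⊥ ∧ ∀ i, d < i → 𝒮 i = ⊥ := by
  classical
  have hex := exists_forall_eq_bot 𝒮
  have hspec := Nat.find_spec hex
  have hpos : Nat.find hex ≠ 0 := fun h => by
    have := hS.nontrivial
    rw [h] at hspec
    exact one_ne_zero ((Submodule.eq_bot_iff _).mp (hspec 0 le_rfl) (1 : S)
      (SetLike.GradedOne.one_mem (A := 𝒮)))
  obtain ⟨d, hd⟩ := Nat.exists_eq_succ_of_ne_zero hpos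
  refine ⟨d, fun h => Nat.find_min hex (m := d) (by omega) fun i hi => ?_,
    fun i hi => hspec i (by omega)⟩
  rcases hi.eq_or_lt with rfl | hi
  · exact h
  · exact hspec i (by omega)

theorem mul_eq_zero_of_mem_top {d : ℕ} (hd : ∀ i, d < i → 𝒮 i = ⊥) {s : S} (hs : s ∈ 𝒮 d) :
    ∀ a ∈ gradedMaximalIdeal 𝒮, a * s = 0 := fun a ha => by
  have hle : gradedMaximalIdeal 𝒮 ≤ LinearMap.ker (LinearMap.mulRight S s) := by
    refine Ideal.span_le.mpr ?_
    rintro a ⟨i, hi, ha⟩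
    exact (Submodule.eq_bot_iff _).mp (hd (i + d) (by omega)) _ (SetLike.GradedMul.mul_mem ha hs)
  exact hle ha

/-- The socle of a self-injective graded algebra is one-dimensional. -/
theorem IsStandardGraded.exists_smul_eq (hS : IsStandardGraded 𝒮) (hinj : Module.Injective S S)
    {x y : S} (hx0 : x ≠ 0) (hx : ∀ a ∈ gradedMaximalIdeal 𝒮, a * x = 0)
    (hy : ∀ a ∈ gradedMaximalIdeal 𝒮, a * y = 0) : ∃ c : k, y = c • x := by
  let F : (S ⧸ gradedMaximalIdeal 𝒮) →ₗ[S] S :=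
    (gradedMaximalIdeal 𝒮).liftQ (LinearMap.toSpanSingleton S S x) fun a ha => hx a ha
  let G : (S ⧸ gradedMaximalIdeal 𝒮) →ₗ[S] S :=
    (gradedMaximalIdeal 𝒮).liftQ (LinearMap.toSpanSingleton S S y) fun a ha => hy a ha
  have hF : Function.Injective F := by
    rw [← LinearMap.ker_eq_bot]
    refine Submodule.ker_liftQ_eq_bot _ _ _ fun a ha => ?_
    have ha : a * x = 0 := ha
    obtain ⟨c, hc⟩ := hS.exists_sub_mem a
    have h := hx _ hc
    rw [sub_mul, ha, zero_sub, neg_eq_zero, ← Algebra.smul_def] at h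
    rwa [(smul_eq_zero.mp h).resolve_right hx0, map_zero, sub_zero] at hc
  -- Injectivity extends `G` along the embedding `F` of the residue field, giving an endomorphism of
  -- `S` with x ↦ y. It is multiplication by `H 1`, which acts on `x` through its scalar part.
  obtain ⟨H, hH⟩ := hinj.out F hF G
  have h1 : H x = y := by
    have h : H ((1 : S) * x) = (1 : S) * y := hH (Submodule.Quotient.mk 1)
    rwa [one_mul, one_mul] at h
  obtain ⟨c, hc⟩ := hS.exists_sub_mem (H 1)
  refine ⟨c, ?_⟩
  have h := hx _ hc
  have hHx : H x = x * H 1 := by rw [← smul_eq_mul, ← map_smul, smul_eq_mul, mul_one]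
  rw [← h1, hHx, Algebra.smul_def]
  linear_combination h

/-- A standard graded Gorenstein algebra has a top degree `d` spanning the socle, and a
nondegenerate functional concentrated in degree `d`. -/
theorem IsStandardGraded.exists_frobenius (hS : IsStandardGraded 𝒮)
    (hG : IsArtinianGorenstein S) :
    ∃ (d : ℕ) (x : S) (l : S →ₗ[k] k), x ∈ 𝒮 d ∧ x ≠ 0 ∧ (∀ i, d < i → 𝒮 i = ⊥) ∧
      (∀ z, z ∈ socle S ↔ ∃ c : k, z = c • x) ∧ (∀ i, i ≠ d → ∀ a ∈ 𝒮 i, l a = 0) ∧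
      (∀ a, (∀ b, l (a * b) = 0) → a = 0) := by
  have := hG.artinian
  obtain ⟨d, hd0, hd⟩ := hS.exists_top_degree
  obtain ⟨x, hx, hx0⟩ := Submodule.exists_mem_ne_zero_of_ne_bot hd0
  have hxn := mul_eq_zero_of_mem_top hd hx
  obtain ⟨ψ, hψ⟩ : ∃ ψ : Module.Dual k S, ψ x ≠ 0 := by
    by_contra! h
    exact hx0 ((Module.forall_dual_apply_eq_zero_iff k x).mp h)
  refine ⟨d, x, ψ ∘ₗ proj 𝒮 d, hx, hx0, hd, fun z => ?_, fun i hi a ha => ?_, fun a ha => ?_⟩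
  · rw [hS.mem_socle]
    refine ⟨fun hz => hS.exists_smul_eq hG.injective hx0 hxn hz, ?_⟩
    rintro ⟨c, rfl⟩ a ha
    rw [mul_smul_comm, hxn a ha, smul_zero]
  · rw [LinearMap.comp_apply, proj_eq_zero ha hi, map_zero]
  -- The radical of the pairing is an ideal; if nonzero it would contain a nonzero multiple of `x`,
  -- on which the functional does not vanish.
  · let I : Ideal S :=
      { carrier := {a | ∀ b, (ψ ∘ₗ proj 𝒮 d) (a * b) = 0}
        zero_mem' := fun b => by rw [zero_mul, map_zero]
        add_mem' := fun ha hb c => by rw [add_mul, map_add, ha, hb, add_zero]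
        smul_mem' := fun r a ha b => by rw [smul_eq_mul, mul_comm r, mul_assoc, ha] }
    have hI : I = ⊥ := by
      by_contra hI
      obtain ⟨z, hz, hz0, hzn⟩ :=
        exists_mem_ne_zero_of_isNilpotent (isNilpotent_gradedMaximalIdeal 𝒮) hI
      obtain ⟨c, rfl⟩ := hS.exists_smul_eq hG.injective hx0 hxn hzn
      have h1 : (ψ ∘ₗ proj 𝒮 d) (c • x * 1) = 0 := hz 1
      rw [mul_one, map_smul, LinearMap.comp_apply, proj_eq_self hx] at h1
      have hc : c = 0 := (smul_eq_zero.mp h1).resolve_right hψ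
      exact hz0 (by rw [hc, zero_smul])
    have : a ∈ I := ha
    rwa [hI, Submodule.mem_bot] at this

variable {R : Type v} [CommRing R] [Algebra k R] {𝒜 : ℕ → Submodule k R} [GradedAlgebra 𝒜]
  {π : S →ₐ[k] R}

theorem map_mem_gradedMaximalIdeal_iff (hgr : ∀ i : ℕ, ∀ s ∈ 𝒮 i, π s ∈ 𝒜 i)
    (hS : IsStandardGraded 𝒮) (hR : IsStandardGraded 𝒜) {s : S} :
    π s ∈ gradedMaximalIdeal 𝒜 ↔ s ∈ gradedMaximalIdeal 𝒮 := by
  rw [mem_gradedMaximalIdeal, mem_gradedMaximalIdeal, ← map_proj_of_graded hgr]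
  obtain ⟨c, hc⟩ := (hS.mem_zero_iff _).mp (proj_mem 𝒮 0 s)
  rw [← hc, AlgHom.commutes, map_eq_zero_iff _ hR.algebraMap_injective,
    map_eq_zero_iff _ hS.algebraMap_injective]

/-- The socle of `R = S / Soc(S)` is concentrated in one degree below the socle of `S`. -/
theorem mem_of_mem_socle_quotient (hS : IsStandardGraded 𝒮) (hR : IsStandardGraded 𝒜)
    [IsArtinianRing R] [IsArtinianRing S] (hgr : ∀ i : ℕ, ∀ s ∈ 𝒮 i, π s ∈ 𝒜 i)
    (hsurj : Function.Surjective π)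
    (hker : RingHom.ker π = socle S) {d : ℕ} (hsoc : ∀ z ∈ socle S, z ∈ 𝒮 (d + 1)) {r : R}
    (hr : r ∈ socle R) : r ∈ 𝒜 d := by
  obtain ⟨s, rfl⟩ := hsurj r
  refine mem_of_proj_eq_zero fun i hi => ?_
  rw [← map_proj_of_graded hgr, ← RingHom.mem_ker, hker, hS.mem_socle]
  -- For `a` of degree one, `a * s` lies in Soc(S), hence in degree `d + 1`, so `a` kills the
  -- components of `s` of degree other than `d`. Degree one generates the maximal ideal.
  have hle : gradedMaximalIdeal 𝒮 ≤ LinearMap.ker (LinearMap.mulRight S (proj 𝒮 i s)) := by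
    refine hS.gradedMaximalIdeal_le_span.trans (Ideal.span_le.mpr fun a ha => ?_)
    have ham := mem_gradedMaximalIdeal_of_mem one_pos ha
    have has : a * s ∈ 𝒮 (d + 1) := by
      refine hsoc _ ?_
      rw [← hker, RingHom.mem_ker, map_mul]
      exact hR.mem_socle.mp hr _ ((map_mem_gradedMaximalIdeal_iff hgr hS hR).mpr ham)
    have h := proj_mul_of_le ha (Nat.le_add_left 1 i) s
    rw [Nat.add_sub_cancel, proj_eq_zero has (by omega)] at h
    exact h.symm
  exact fun a ha => hle ha

/-- The graded surjection `ω(-d) → 𝔪` for the quotient of a Gorenstein algebra by its socle. -/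
theorem exists_isGradedSurjection (hS : IsStandardGraded 𝒮) (hR : IsStandardGraded 𝒜)
    [IsArtinianRing S] (hgr : ∀ i : ℕ, ∀ s ∈ 𝒮 i, π s ∈ 𝒜 i) (hsurj : Function.Surjective π)
    (hker : RingHom.ker π = socle S) {d : ℕ} {x : S} (hx0 : x ≠ 0)
    (hx : x ∈ socle S) {l : S →ₗ[k] k}
    (hd : ∀ i, d < i → 𝒮 i = ⊥) (hl : ∀ i, i ≠ d → ∀ a ∈ 𝒮 i, l a = 0)
    (hnd : ∀ a, (∀ b, l (a * b) = 0) → a = 0) :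
    ∃ f : CanonicalModule k R →ₗ[R] gradedMaximalIdeal 𝒜, IsGradedSurjection 𝒜 (-d) f := by
  have := hS.finite
  have hinj : ∀ {a b : S}, (∀ s, l (a * s) = l (b * s)) → a = b := fun h =>
    sub_eq_zero.mp (hnd _ fun s => by rw [sub_mul, map_sub, h, sub_self])
  choose g hg using fun φ : CanonicalModule k R =>
    exists_functional_eq_mul l hnd (toDual φ ∘ₗ π.toLinearMap)
  have hg : ∀ φ s, l (g φ * s) = φ (π s) := hg
  have hπx : π x = 0 := by rwa [← RingHom.mem_ker, hker]
  -- If the scalar part of `g φ` were nonzero, `g φ` could not kill `x`; but it does, since π(x) =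
  -- 0.
  have hgm : ∀ φ, g φ ∈ gradedMaximalIdeal 𝒮 := fun φ => by
    obtain ⟨c, hc⟩ := hS.exists_sub_mem (g φ)
    have h := hS.mem_socle.mp hx _ hc
    rw [sub_mul, sub_eq_zero] at h
    have hcx : algebraMap k S c * x = 0 := hnd _ fun s => by
      rw [← h, mul_assoc, hg, map_mul, hπx, zero_mul, map_zero']
    rw [← Algebra.smul_def] at hcx
    rwa [(smul_eq_zero.mp hcx).resolve_right hx0, map_zero, sub_zero] at hc
  let f : CanonicalModule k R →ₗ[R] gradedMaximalIdeal 𝒜 :=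
    { toFun := fun φ => ⟨π (g φ), (map_mem_gradedMaximalIdeal_iff hgr hS hR).mpr (hgm φ)⟩
      map_add' := fun φ ψ => Subtype.ext (by
        have : g (φ + ψ) = g φ + g ψ := hinj fun s => by
          rw [add_mul, map_add, hg, hg, hg, CanonicalModule.add_apply]
        simp only [this, map_add, Submodule.coe_add])
      map_smul' := fun r φ => Subtype.ext (by
        obtain ⟨s, rfl⟩ := hsurj r
        have : g (π s • φ) = s * g φ := hinj fun a => by
          rw [mul_comm s, mul_assoc, hg, hg, CanonicalModule.smul_apply, map_mul π]
        simp only [this, map_mul, RingHom.id_apply, SetLike.val_smul, smul_eq_mul]) }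
  have hf : ∀ φ, (f φ : R) = π (g φ) := fun φ => rfl
  refine ⟨f, fun r => ?_, fun i φ hφ => ?_⟩
  · obtain ⟨s, hs⟩ := hsurj r
    have hsm : s ∈ gradedMaximalIdeal 𝒮 :=
      (map_mem_gradedMaximalIdeal_iff hgr hS hR).mp (hs ▸ r.2)
    obtain ⟨σ, hσ⟩ := LinearMap.exists_rightInverse_of_surjective π.toLinearMap
      (LinearMap.range_eq_top.mpr hsurj)
    have hσ : ∀ a, π (σ a) = a := fun a => LinearMap.congr_fun hσ a
    -- The choice of section is harmless: `s` lies in the maximal ideal, which kills Soc(S) = ker π,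
    -- so s·σ(π(a)) = s·a.
    let φ : CanonicalModule k R := toDual.symm (l ∘ₗ LinearMap.mulLeft k s ∘ₗ σ)
    refine ⟨φ, Subtype.ext ?_⟩
    rw [hf, ← hs]
    congr 1
    refine hinj fun a => ?_
    rw [hg]
    change l (s * σ (π a)) = l (s * a)
    have hsoc : σ (π a) - a ∈ socle S := by
      rw [← hker, RingHom.mem_ker, map_sub, hσ, sub_self]
    have h := hS.mem_socle.mp hsoc s hsm
    rw [mul_sub, sub_eq_zero] at h
    rw [h]
  · rw [hf]
    -- The degree `j` part of `g φ` pairs only with degree `d - j`, through the values of `φ` there;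
    -- these vanish unless `j = i`.
    have hcomp : ∀ j : ℕ, (j : ℤ) ≠ i → proj 𝒮 j (g φ) = 0 := fun j hj => by
      rcases lt_or_ge d j with hdj | hdj
      · exact (Submodule.eq_bot_iff _).mp (hd j hdj) _ (proj_mem 𝒮 j _)
      refine hnd _ fun b => ?_
      have hhom : ∀ (m : ℕ), ∀ b ∈ 𝒮 m, l (proj 𝒮 j (g φ) * b) = 0 := fun m b hb => by
        by_cases hm : j + m = d
        · have hlg : l (g φ * b) = l (proj 𝒮 j (g φ) * b) := by
            have hlp : ∀ a, l a = l (proj 𝒮 d a) := fun a => by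
              induction a using DirectSum.Decomposition.inductionOn 𝒮 with
              | zero => rw [map_zero, map_zero, map_zero]
              | homogeneous a =>
                rename_i e
                by_cases he : e = d
                · subst he
                  rw [proj_eq_self a.2]
                · rw [hl e he a a.2, proj_eq_zero a.2 he, map_zero]
              | add a b ha hb => rw [map_add, map_add, map_add, ha, hb]
            rw [hlp, mul_comm (g φ), proj_mul_of_le hb (by omega), mul_comm b,
              show d - m = j by omega]
          rw [← hlg, hg]
          exact hφ m (by omega) _ (hgr m b hb)
        · exact hl _ hm _ (SetLike.GradedMul.mul_mem (proj_mem 𝒮 j _) hb)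
      induction b using DirectSum.Decomposition.inductionOn 𝒮 with
      | zero => rw [mul_zero, map_zero]
      | homogeneous b => exact hhom _ b b.2
      | add a b ha hb => rw [mul_add, map_add, ha, hb, add_zero]
    rcases i with n | n
    · refine hgr n _ (mem_of_proj_eq_zero fun j hj => hcomp j ?_)
      simpa using hj
    · have : g φ = 0 := eq_zero_of_proj_eq_zero (𝒜 := 𝒮) fun j => hcomp j (by
        rw [Int.negSucc_eq]; omega)
      rw [this, map_zero]
      exact zero_mem _

end Gorenstein

/-! ### Assembly of the theorem. -/

/-- If the socle lies in `𝔪²`, every graded surjection `f : ω(t) → 𝔪` makes `k ⊕ ω(t)` a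
Gorenstein algebra with quotient `R` by its socle. -/
theorem exists_gorenstein_cover_of_socle_le {k : Type u} {R : Type v} [Field k] [CommRing R]
    [Algebra k R] [IsArtinianRing R] {𝒜 : ℕ → Submodule k R} [GradedAlgebra 𝒜]
    (hR : IsStandardGraded 𝒜) (h2 : (2 : k) ≠ 0) (hsoc : socle R ≤ gradedMaximalIdeal 𝒜 ^ 2)
    {t : ℤ} {f : CanonicalModule k R →ₗ[R] gradedMaximalIdeal 𝒜}
    (hf : IsGradedSurjection 𝒜 t f) :
    ∃ (S : Type (max u v)) (_ : CommRing S) (_ : Algebra k S)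
      (𝒮 : ℕ → Submodule k S) (_ : GradedAlgebra 𝒮) (π : S →ₐ[k] R)
      (e : S ≃ₗ[k] k × CanonicalModule k R),
      e 1 = (1, 0) ∧
      (∀ a b : S, e (a * b) =
        ((e a).1 * (e b).1,
          (e a).1 • (e b).2 + (e b).1 • (e a).2 +
            (2 : k)⁻¹ • ((f (e b).2 : R) • (e a).2 + (f (e a).2 : R) • (e b).2))) ∧
      (∀ (i : ℕ) (s : S), s ∈ 𝒮 i ↔
        (i ≠ 0 → (e s).1 = 0) ∧ (e s).2 ∈ canonicalGrading 𝒜 (t + i)) ∧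
      (∀ s : S, π s = algebraMap k R (e s).1 + (f (e s).2 : R)) ∧
      IsGorensteinModSocle 𝒮 𝒜 π := by
  have hnt := hR.nontrivial
  -- If 𝔪 = 0, then 1 would lie in Soc(R) ⊆ 𝔪² = 0.
  have hm : gradedMaximalIdeal 𝒜 ≠ ⊥ := fun hm => by
    have h1 : (1 : R) ∈ socle R := hR.mem_socle.mpr fun a ha => by
      rw [hm, Submodule.mem_bot] at ha
      rw [ha, zero_mul]
    have h := Ideal.pow_le_self two_ne_zero (hsoc h1)
    rw [hm, Submodule.mem_bot] at h
    exact one_ne_zero h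
  have hbot := fun j : ℕ => eq_bot_of_isGradedSurjection hR hf hm (j := j)
  have ht : t < 0 := by
    by_contra ht
    exact one_ne_zero ((Submodule.eq_bot_iff _).mp (hbot 0 (by push_cast; omega)) (1 : R)
      (SetLike.GradedOne.one_mem (A := 𝒜)))
  obtain ⟨d, rfl⟩ : ∃ d : ℕ, t = -d := ⟨t.natAbs, by omega⟩
  exact exists_gorenstein_cover hR hf h2 (fun i hi => hbot i (by omega))
    (toRing_eq_zero_of_socle_le hR hf.surjective h2 hsoc) fun h => absurd h hm

theorem theorem2p6 {k : Type u} {R : Type v} [Field k] (hchar : ringChar k ≠ 2)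
    [CommRing R] [Algebra k R] [IsArtinianRing R]
    (𝒜 : ℕ → Submodule k R) [GradedAlgebra 𝒜] (hR : IsStandardGraded 𝒜) :
    -- the equivalence
    ((IsPolynomialModSquare 𝒜 ∨
        (socle R ≤ gradedMaximalIdeal 𝒜 ^ 2 ∧
          ∃ (t : ℤ) (f : CanonicalModule k R →ₗ[R] gradedMaximalIdeal 𝒜),
            IsGradedSurjection 𝒜 t f)) ↔
      ∃ (S : Type (max u v)) (_ : CommRing S) (_ : Algebra k S)
        (𝒮 : ℕ → Submodule k S) (_ : GradedAlgebra 𝒮) (π : S →ₐ[k] R),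
        IsGorensteinModSocle 𝒮 𝒜 π) ∧
    -- the explicit Gorenstein ring `S = k ⊕ ω(t)`
    (socle R ≤ gradedMaximalIdeal 𝒜 ^ 2 →
      ∀ (t : ℤ) (f : CanonicalModule k R →ₗ[R] gradedMaximalIdeal 𝒜),
        IsGradedSurjection 𝒜 t f →
        ∃ (S : Type (max u v)) (_ : CommRing S) (_ : Algebra k S)
          (𝒮 : ℕ → Submodule k S) (_ : GradedAlgebra 𝒮) (π : S →ₐ[k] R)
          (e : S ≃ₗ[k] k × CanonicalModule k R),
          e 1 = (1, 0) ∧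
          (∀ a b : S, e (a * b) =
            ((e a).1 * (e b).1,
              (e a).1 • (e b).2 + (e b).1 • (e a).2 +
                (2 : k)⁻¹ • ((f (e b).2 : R) • (e a).2 + (f (e a).2 : R) • (e b).2))) ∧
          (∀ (i : ℕ) (s : S), s ∈ 𝒮 i ↔
            (i ≠ 0 → (e s).1 = 0) ∧ (e s).2 ∈ canonicalGrading 𝒜 (t + i)) ∧
          (∀ s : S, π s = algebraMap k R (e s).1 + (f (e s).2 : R)) ∧
          IsGorensteinModSocle 𝒮 𝒜 π) := by
  have h2 : (2 : k) ≠ 0 := Ring.two_ne_zero hchar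
  refine ⟨⟨?_, ?_⟩, fun hsoc t f hf => exists_gorenstein_cover_of_socle_le hR h2 hsoc hf⟩
  · rintro (hpoly | ⟨hsoc, t, f, hf⟩)
    · exact exists_gorenstein_cover_of_eq_bot hR h2 fun i hi => hpoly.eq_bot hi
    · obtain ⟨S, i₁, i₂, 𝒮, i₃, π, e, -, -, -, -, h⟩ :=
        exists_gorenstein_cover_of_socle_le hR h2 hsoc hf
      exact ⟨S, i₁, i₂, 𝒮, i₃, π, h⟩
  · rintro ⟨S, _, _, 𝒮, _, π, hS, hG, hsurj, hgr, hker⟩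
    have := hG.artinian
    obtain ⟨d, x, l, hx, hx0, hd, hsoc, hl, hnd⟩ := hS.exists_frobenius hG
    -- In degree 0 the socle generator would be a nonzero scalar killed by `π`.
    have hd0 : d ≠ 0 := by
      rintro rfl
      obtain ⟨c, rfl⟩ := (hS.mem_zero_iff x).mp hx
      have h0 : algebraMap k S c ∈ RingHom.ker π := by
        rw [hker]
        exact (hsoc _).mpr ⟨1, (one_smul _ _).symm⟩
      rw [RingHom.mem_ker, AlgHom.commutes, map_eq_zero_iff _ hR.algebraMap_injective] at h0
      exact hx0 (by rw [h0, map_zero])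
    -- In degrees i ≥ 2 ≥ d everything in `S` is socle, so `R` vanishes there; for d ≥ 3 the socle
    -- of `R` has degree d - 1 ≥ 2.
    by_cases hd2 : d ≤ 2
    · refine Or.inl (hR.isPolynomialModSquare fun i hi => ?_)
      refine (Submodule.eq_bot_iff _).mpr fun a ha => ?_
      obtain ⟨s, hs, rfl⟩ := exists_mem_of_graded_surjective hgr hsurj ha
      rw [← RingHom.mem_ker, hker, hS.mem_socle]
      refine mul_eq_zero_of_mem_top (fun j hj => hd j (by omega)) hs
    · refine Or.inr ⟨fun r hr => ?_, -d, exists_isGradedSurjection hS hR hgr hsurj hker hx0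
        ((hsoc x).mpr ⟨1, (one_smul _ _).symm⟩) hd hl hnd⟩
      obtain ⟨e, rfl⟩ := Nat.exists_eq_succ_of_ne_zero hd0
      refine hR.mem_sq_of_mem (i := e) (by omega)
        (mem_of_mem_socle_quotient hS hR hgr hsurj hker (fun z hz => ?_) hr)
      obtain ⟨c, rfl⟩ := (hsoc z).mp hz
      exact Submodule.smul_mem _ _ hx
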